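/- Let $n\ge 1$ and $1<p<\infty$. For a bounded, compactly supported measurable function $f$ on $\mathbb{R}^n$ let $$R_1f(x)=c_n\lim_{\varepsilon\to0^+}\int_{|y|>\varepsilon}\frac{y_1}{|y|^{n+1}}f(x-y)\,dy,\qquad c_n=\frac{\Gamma\left(\frac{n+1}{2}\right)}{\pi^{\frac{n+1}{2}}},$$ be its first Riesz transform, wherever the limit exists (for $n=1$ this is the Hilbert transform). For an interval $I=[a,a+\ell)$ and an integer $k\ge1$ let $s_k^I$ be the function that vanishes off $I$ and takes the values $+1,-1,+1,-1,\dots,+1,-1$, from left to right, on the $2^k$ dyadic subintervals of $I$ of length $2^{-k}\ell$. For an axis-parallel cube $Q=Q_1\times\dots\times Q_n\subset\mathbb{R}^n$ let $$s_k^{Q,\mathrm{horizontal}}(x)=s_k^{Q_1}(x_1)\,\mathbf 1_{Q_2\times\dots\times Q_n}(x_2,\dots,x_n).$$ We say that $f_k\to0$ weakly in $L^p(\mathbb{R}^n)$ if $f_k\in L^p(\mathbb{R}^n)$ for all $k$ and $\lim_{k\to\infty}\int_{\mathbb{R}^n}f_k\,b\,dx=0$ for all $b\in L^{p'}(\mathbb{R}^n)$,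 where $\frac1p+\frac1{p'}=1$. Theorem. For every cube $P$ and every $k$, the principal value $R_1s_k^{P,\mathrm{horizontal}}(x)$ exists for almost every $x\in\mathbb{R}^n$. Let $I,J,K$ be cubes of the same side length in a common dyadic grid $\{a+2^mL(z+[0,1)^n):m\in\mathbb{Z},\,z\in\mathbb{Z}^n\}$, where $a\in\mathbb{R}^n$ and $L>0$. Then, as $k\to\infty$, $$s_k^{I,\mathrm{horizontal}}\,\bigl(R_1s_k^{J,\mathrm{horizontal}}\bigr)\to0\quad\text{weakly in }L^p(\mathbb{R}^n),$$ $$\bigl(R_1s_k^{I,\mathrm{horizontal}}\bigr)\bigl(R_1s_k^{J,\mathrm{horizontal}}\bigr)\to0\quad\text{weakly in }L^p(\mathbb{R}^n)\text{ if }I\ne J,$$ $$s_k^{I,\mathrm{horizontal}}\,\bigl(R_1s_k^{J,\mathrm{horizontal}}\bigr)\bigl(R_1s_k^{K,\mathrm{horizontal}}\bigr)\to0\quad\text{weakly in }L^p(\mathbb{R}^n).$$ -/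

import Mathlib

open Filter Topology MeasureTheory

noncomputable section

/-- An axis-parallel cube `∏ i, [corner i, corner i + side)` in `ℝⁿ`. -/
@[ext]
structure Cube (n : ℕ) where
  corner : Fin n → ℝ
  side : ℝ
  side_pos : 0 < side

/-- The dyadic grid generated by a cube `Q₀` with corner `a` and side length `L`: all cubes
`a + 2 ^ m L (z + [0, 1)ⁿ)` with `m : ℤ` and `z : ℤⁿ`. It contains all the dyadic subcubes
of `Q₀`; for `Q₀ = [0, 1)ⁿ` it is the standard dyadic grid of `ℝⁿ`. -/
def dyadicGrid {n : ℕ} (Q₀ : Cube n) : Set (Cube n) :=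
  {Q | (∃ m : ℤ, Q.side = 2 ^ m * Q₀.side) ∧
    ∃ z : Fin n → ℤ, ∀ i, Q.corner i = Q₀.corner i + z i * Q.side}

/-- The `L^∞`-normalized Haar function of the interval `[c, c + h)`: `1` on the left half and
`-1` on the right half. -/
def haarSign (c h t : ℝ) : ℝ :=
  (Set.Ico c (c + h / 2)).indicator 1 t - (Set.Ico (c + h / 2) (c + h)).indicator 1 t

/-- The alternating function `s_k` of the interval `[a, a + ℓ)`, for `k ≥ 1`: the sum of the
normalized Haar functions of the `2 ^ (k - 1)` dyadic subintervals of generation `k - 1`. -/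
def alternating (a ℓ : ℝ) (k : ℕ) (t : ℝ) : ℝ :=
  ∑ i ∈ Finset.range (2 ^ (k - 1)),
    haarSign (a + i * (ℓ / 2 ^ (k - 1))) (ℓ / 2 ^ (k - 1)) t

/-- The horizontal alternating function of a cube `Q = Q₁ × ⋯ × Qₙ`, that is
`x ↦ s_k^{Q₁}(x₁) 1_{Q₂ × ⋯ × Qₙ}(x₂, …, xₙ)`. -/
def alternatingHorizontal {n : ℕ} [NeZero n] (Q : Cube n) (k : ℕ)
    (x : EuclideanSpace ℝ (Fin n)) : ℝ :=
  alternating (Q.corner 0) Q.side k (x 0) *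
    {y : EuclideanSpace ℝ (Fin n) |
      ∀ i, i ≠ 0 → y i ∈ Set.Ico (Q.corner i) (Q.corner i + Q.side)}.indicator 1 x

/-- The Riesz kernel `c_n y_j / |y| ^ (n + 1)`, with `c_n = Γ((n + 1) / 2) / π ^ ((n + 1) / 2)`. -/
def rieszKernel {n : ℕ} (j : Fin n) (y : EuclideanSpace ℝ (Fin n)) : ℝ :=
  Real.Gamma (((n : ℝ) + 1) / 2) / Real.pi ^ (((n : ℝ) + 1) / 2) * (y j / ‖y‖ ^ (n + 1))

/-- The truncated Riesz transform, with integration over `|y| > ε`. -/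
def rieszTruncated {n : ℕ} (j : Fin n) (ε : ℝ) (f : EuclideanSpace ℝ (Fin n) → ℝ)
    (x : EuclideanSpace ℝ (Fin n)) : ℝ :=
  ∫ y in {y : EuclideanSpace ℝ (Fin n) | ε < ‖y‖}, rieszKernel j y * f (x - y)

/-- The Riesz transform `R_j f (x)`, a principal value integral. -/
def rieszTransform {n : ℕ} (j : Fin n) (f : EuclideanSpace ℝ (Fin n) → ℝ)
    (x : EuclideanSpace ℝ (Fin n)) : ℝ :=
  limUnder (𝓝[>] (0 : ℝ)) fun ε => rieszTruncated j ε f x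

/-- The principal value defining `R_j f (x)` exists: the truncated integrals converge absolutely,
and they have a limit as the truncation is removed (the limit is then `rieszTransform j f x`). -/
def RieszPVExists {n : ℕ} (j : Fin n) (f : EuclideanSpace ℝ (Fin n) → ℝ)
    (x : EuclideanSpace ℝ (Fin n)) : Prop :=
  (∀ ε : ℝ, 0 < ε →
    IntegrableOn (fun y => rieszKernel j y * f (x - y))
      {y : EuclideanSpace ℝ (Fin n) | ε < ‖y‖}) ∧
  ∃ l : ℝ, Tendsto (fun ε => rieszTruncated j ε f x) (𝓝[>] (0 : ℝ)) (𝓝 l)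

/-- `f k → 0` weakly in `L^p(ℝⁿ)`, for `1 < p < ∞`: every `f k` is in `L^p`, and
`∫ f k * b → 0` for all `b ∈ L^{p'}`, where `p' = p / (p - 1)`. -/
def WeaklyTendstoZero {n : ℕ} (p : ℝ) (f : ℕ → EuclideanSpace ℝ (Fin n) → ℝ) : Prop :=
  (∀ k, MemLp (f k) (ENNReal.ofReal p)) ∧
  ∀ b : EuclideanSpace ℝ (Fin n) → ℝ, MemLp b (ENNReal.ofReal (p / (p - 1))) →
    Tendsto (fun k => ∫ x, f k x * b x) atTop (𝓝 0)

end

/-!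
The horizontal alternating function of a box is a sum of `N` Haar functions of length `h = s₀ / N`
in the first coordinate. With `δ = h / 2` it equals `g - g (· - δ e₀)`, where `g` is an indicator
function. This difference can be moved onto the Riesz kernel, so that the oscillation cancels at
distances above `δ`, uniformly in `δ`. Since the kernel is odd, a ball on which the function is
constant contributes nothing to the principal value. This gives pointwise bounds.

* Off the hyperplanes where the function jumps, the principal value exists. If the function is
  constant on the ball of radius `r ≤ δ` about `x`, then `|R₁ f x| ≤ C (δ / r) ^ θ` for any `θ > 0`
  (`exists_abs_rieszTransform_le_of_const_near`).
* Off the box, locally `|R₁ f x| ≤ C δ ^ θ r ^ (-2 θ)` for `0 < θ ≤ 1`, where `r` is a lower bound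
  for the distance of `x` to the box, and `R₁ f` decays like `δ |x| ^ (-n - 1)` at infinity
  (`exists_abs_rieszTransform_le_off_support`, `exists_abs_rieszTransform_le_far`).

With `θ` small these bounds are integrated to the power `q`. The first one yields `L^q` bounds
uniform in `N`: the number of jumps is of order `1 / δ`, and each contributes a multiple of `δ`. The
second one shows that `R₁ f → 0` in `L^q` on the complement of the box, as `N → ∞`.

Different cubes of the same size in a dyadic grid are disjoint. Hence, unless all the cubes involved
coincide, some factor in each product tends to zero strongly where the others live, and Hölder's
inequality gives strong convergence. When they coincide, the product is `f (R₁ f) ^ e` with `e = 1`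
or `e = 2`. It is bounded in `L^p`, and is tested against continuous functions of compact support.
The box is cut into thin slabs, on which the test function may be replaced by a function `u` that
does not depend on the first coordinate. On each slab `R₁ f` may be replaced by the Riesz transform
of the oscillation `f'` of the slab alone, because the other slabs contribute a null sequence there.
The resulting integral `∫ f' (R₁ f') ^ e u` vanishes (`integral_boxOsc_mul_eq_zero`): `f'` is odd
about the centre of the slab in the first coordinate, and `R₁` maps odd functions to even ones.
-/

open Filter Topology MeasureTheory

noncomputable section

variable {n : ℕ}

/-! ### The Riesz kernel and its principal values -/

/-- The dimensional constant `c_n` of the Riesz kernels. -/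
def rieszConst (n : ℕ) : ℝ :=
  Real.Gamma (((n : ℝ) + 1) / 2) / Real.pi ^ (((n : ℝ) + 1) / 2)

lemma rieszConst_nonneg (n : ℕ) : 0 ≤ rieszConst n := by
  unfold rieszConst
  have : 0 ≤ Real.Gamma (((n : ℝ) + 1) / 2) := Real.Gamma_nonneg_of_nonneg (by positivity)
  positivity

lemma rieszKernel_eq (j : Fin n) (y : EuclideanSpace ℝ (Fin n)) :
    rieszKernel j y = rieszConst n * (y j / ‖y‖ ^ (n + 1)) := rfl

lemma rieszKernel_neg (j : Fin n) (y : EuclideanSpace ℝ (Fin n)) :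
    rieszKernel j (-y) = -rieszKernel j y := by
  simp [rieszKernel_eq, neg_div]

lemma measurable_rieszKernel (j : Fin n) : Measurable (rieszKernel j) := by
  unfold rieszKernel
  fun_prop

lemma abs_coord_le_norm (y : EuclideanSpace ℝ (Fin n)) (j : Fin n) : |y j| ≤ ‖y‖ := by
  simpa using PiLp.norm_apply_le y j

lemma abs_rieszKernel_le (j : Fin n) (y : EuclideanSpace ℝ (Fin n)) :
    |rieszKernel j y| ≤ rieszConst n / ‖y‖ ^ n := by
  rw [rieszKernel_eq, abs_mul, abs_of_nonneg (rieszConst_nonneg n),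
    div_eq_mul_one_div (rieszConst n)]
  refine mul_le_mul_of_nonneg_left ?_ (rieszConst_nonneg n)
  rcases eq_or_ne y 0 with rfl | hy
  · simp
  have hy' : 0 < ‖y‖ := norm_pos_iff.2 hy
  rw [abs_div, abs_of_nonneg (by positivity : 0 ≤ ‖y‖ ^ (n + 1)),
    div_le_div_iff₀ (by positivity) (by positivity)]
  have := mul_le_mul_of_nonneg_right (abs_coord_le_norm y j) (by positivity : 0 ≤ ‖y‖ ^ n)
  rw [one_mul, pow_succ]
  linarith

/-- The constant in the smoothness estimate of the Riesz kernels. -/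
def rieszSmoothConst (n : ℕ) : ℝ := rieszConst n * (1 + 2 ^ n * ((n + 1) * 2 ^ n))

lemma rieszSmoothConst_nonneg (n : ℕ) : 0 ≤ rieszSmoothConst n :=
  mul_nonneg (rieszConst_nonneg n) (by positivity)

/-- The standard smoothness estimate of the Calderón–Zygmund kernel `rieszKernel j`. -/
lemma abs_rieszKernel_sub_le (j : Fin n) {y v : EuclideanSpace ℝ (Fin n)} (h : 2 * ‖v‖ ≤ ‖y‖) :
    |rieszKernel j y - rieszKernel j (y - v)| ≤ rieszSmoothConst n * (‖v‖ / ‖y‖ ^ (n + 1)) := by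
  rcases eq_or_ne y 0 with rfl | hy
  · have hv : v = 0 := by
      have := norm_nonneg v
      rw [norm_zero] at h
      exact norm_eq_zero.1 (by linarith)
    simp [hv]
  have hy' : 0 < ‖y‖ := norm_pos_iff.2 hy
  set z := y - v with hz
  have hv0 := norm_nonneg v
  have hyz : |‖z‖ - ‖y‖| ≤ ‖v‖ := by
    have := abs_norm_sub_norm_le z y
    simpa [hz] using this
  have hz1 : ‖y‖ / 2 ≤ ‖z‖ := by have := (abs_le.1 hyz).1; linarith
  have hz2 : ‖z‖ ≤ 2 * ‖y‖ := by have := (abs_le.1 hyz).2; linarith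
  have hz' : 0 < ‖z‖ := by linarith
  have key : y j / ‖y‖ ^ (n + 1) - z j / ‖z‖ ^ (n + 1)
      = v j / ‖y‖ ^ (n + 1) +
        z j * (‖z‖ ^ (n + 1) - ‖y‖ ^ (n + 1)) / (‖y‖ ^ (n + 1) * ‖z‖ ^ (n + 1)) := by
    have : y j = z j + v j := by simp [hz]
    rw [this]
    field_simp
    ring
  have hpow : |‖z‖ ^ (n + 1) - ‖y‖ ^ (n + 1)| ≤ ‖v‖ * (n + 1) * (2 * ‖y‖) ^ n := by
    refine (abs_pow_sub_pow_le _ _ _).trans ?_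
    have : max |‖z‖| |‖y‖| ≤ 2 * ‖y‖ := by
      rw [abs_of_pos hz', abs_of_pos hy']
      exact max_le hz2 (by linarith)
    have h2 : (max |‖z‖| |‖y‖|) ^ (n + 1 - 1) ≤ (2 * ‖y‖) ^ n := by
      rw [Nat.add_sub_cancel]
      exact pow_le_pow_left₀ (by positivity) this n
    push_cast
    gcongr
  have h1 : |v j / ‖y‖ ^ (n + 1)| ≤ ‖v‖ / ‖y‖ ^ (n + 1) := by
    rw [abs_div, abs_of_nonneg (by positivity : 0 ≤ ‖y‖ ^ (n + 1))]
    gcongr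
    exact abs_coord_le_norm v j
  have h2 : |z j * (‖z‖ ^ (n + 1) - ‖y‖ ^ (n + 1)) / (‖y‖ ^ (n + 1) * ‖z‖ ^ (n + 1))|
      ≤ 2 ^ n * ((n + 1) * 2 ^ n) * (‖v‖ / ‖y‖ ^ (n + 1)) := by
    rw [abs_div, abs_mul, abs_of_nonneg (by positivity : 0 ≤ ‖y‖ ^ (n + 1) * ‖z‖ ^ (n + 1)),
      div_le_iff₀ (by positivity)]
    have e : 2 ^ n * ((n + 1) * 2 ^ n) * (‖v‖ / ‖y‖ ^ (n + 1)) * (‖y‖ ^ (n + 1) * ‖z‖ ^ (n + 1))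
        = ‖z‖ * (2 ^ n * ‖z‖ ^ n) * (‖v‖ * (n + 1) * 2 ^ n) := by
      field_simp
      ring
    rw [e]
    have e2 : ‖y‖ ^ n ≤ 2 ^ n * ‖z‖ ^ n := by
      rw [← mul_pow]; exact pow_le_pow_left₀ hy'.le (by linarith) n
    calc |z j| * |‖z‖ ^ (n + 1) - ‖y‖ ^ (n + 1)|
        ≤ ‖z‖ * (‖v‖ * (n + 1) * (2 * ‖y‖) ^ n) := by
          gcongr
          exact abs_coord_le_norm z j
      _ = ‖z‖ * ‖y‖ ^ n * (‖v‖ * (n + 1) * 2 ^ n) := by rw [mul_pow]; ring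
      _ ≤ _ := by gcongr
  rw [rieszKernel_eq, rieszKernel_eq, ← mul_sub, key, abs_mul, abs_of_nonneg (rieszConst_nonneg n),
    rieszSmoothConst, mul_assoc]
  refine mul_le_mul_of_nonneg_left ?_ (rieszConst_nonneg n)
  refine (abs_add_le _ _).trans ?_
  linarith

lemma measurableSet_norm_lt (r : ℝ) :
    MeasurableSet {y : EuclideanSpace ℝ (Fin n) | r < ‖y‖} :=
  measurableSet_lt measurable_const measurable_norm

lemma measurableSet_norm_le (r : ℝ) :
    MeasurableSet {y : EuclideanSpace ℝ (Fin n) | r ≤ ‖y‖} :=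
  measurableSet_le measurable_const measurable_norm

/-- Away from the origin the Riesz kernel is bounded, hence integrable against `f`. -/
lemma integrableOn_rieszKernel_mul (j : Fin n) {f : EuclideanSpace ℝ (Fin n) → ℝ}
    (hf : Integrable f) (x : EuclideanSpace ℝ (Fin n)) {r : ℝ} (hr : 0 < r) :
    IntegrableOn (fun y => rieszKernel j y * f (x - y)) {y | r ≤ ‖y‖} := by
  refine Integrable.bdd_mul (c := rieszConst n / r ^ n) (hf.comp_sub_left x).integrableOn
    (measurable_rieszKernel j).aestronglyMeasurable ?_
  filter_upwards [ae_restrict_mem (measurableSet_norm_le r)] with y hy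
  refine (abs_rieszKernel_le j y).trans ?_
  have : r ≤ ‖y‖ := hy
  have := rieszConst_nonneg n
  gcongr

/-- By oddness of the kernel, a symmetric annulus on which `f (x - ·)` is constant contributes
nothing. -/
lemma setIntegral_rieszKernel_annulus (j : Fin n) (ε r : ℝ) :
    ∫ y in {y : EuclideanSpace ℝ (Fin n) | ε < ‖y‖ ∧ ‖y‖ < r}, rieszKernel j y = 0 := by
  have hm : MeasurableSet {y : EuclideanSpace ℝ (Fin n) | ε < ‖y‖ ∧ ‖y‖ < r} :=
    (measurableSet_norm_lt ε).inter (measurableSet_lt measurable_norm measurable_const)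
  rw [← integral_indicator hm]
  set φ := {y : EuclideanSpace ℝ (Fin n) | ε < ‖y‖ ∧ ‖y‖ < r}.indicator (rieszKernel j) with hφ
  have h1 : ∀ y, φ (-y) = -φ y := by
    intro y
    by_cases hy : ε < ‖y‖ ∧ ‖y‖ < r
    · simp [hφ, hy, rieszKernel_neg]
    · simp [hφ, hy]
  have h2 := integral_neg_eq_self φ volume
  simp_rw [h1, integral_neg] at h2
  linarith

/-- If `f` is constant near `x`, the principal value at `x` exists and is an absolutely convergent
integral. -/
lemma rieszTransform_of_const_near (j : Fin n) {f : EuclideanSpace ℝ (Fin n) → ℝ}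
    (hf : Integrable f) {x : EuclideanSpace ℝ (Fin n)} {r : ℝ} (hr : 0 < r)
    (hx : ∀ y, ‖y‖ < r → f (x - y) = f x) :
    RieszPVExists j f x ∧
      rieszTransform j f x = ∫ y in {y | r ≤ ‖y‖}, rieszKernel j y * f (x - y) := by
  have hlt : ∀ ε : ℝ, 0 < ε → IntegrableOn (fun y => rieszKernel j y * f (x - y)) {y | ε < ‖y‖} :=
    fun ε hε => (integrableOn_rieszKernel_mul j hf x hε).mono_set fun y (hy : ε < ‖y‖) => hy.le
  have hT : ∀ ε ∈ Set.Ioo 0 r,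
      rieszTruncated j ε f x = ∫ y in {y | r ≤ ‖y‖}, rieszKernel j y * f (x - y) := by
    intro ε ⟨hε, hεr⟩
    have hset : {y : EuclideanSpace ℝ (Fin n) | ε < ‖y‖} =
        {y | ε < ‖y‖ ∧ ‖y‖ < r} ∪ {y | r ≤ ‖y‖} := by
      ext y
      simp only [Set.mem_ofPred_eq, Set.mem_union]
      constructor
      · intro h
        rcases lt_or_ge ‖y‖ r with h' | h'
        · exact Or.inl ⟨h, h'⟩
        · exact Or.inr h'
      · rintro (h | h)
        · exact h.1
        · exact hεr.trans_le h
    have hm : MeasurableSet {y : EuclideanSpace ℝ (Fin n) | ε < ‖y‖ ∧ ‖y‖ < r} :=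
      (measurableSet_norm_lt ε).inter (measurableSet_lt measurable_norm measurable_const)
    unfold rieszTruncated
    rw [hset, setIntegral_union _ (measurableSet_norm_le r)
      ((hlt ε hε).mono_set fun y hy => hy.1) (integrableOn_rieszKernel_mul j hf x hr)]
    · have : ∫ y in {y | ε < ‖y‖ ∧ ‖y‖ < r}, rieszKernel j y * f (x - y) =
          ∫ y in {y | ε < ‖y‖ ∧ ‖y‖ < r}, rieszKernel j y * f x :=
        setIntegral_congr_fun hm fun y hy => by rw [hx y hy.2]
      rw [this, integral_mul_const, setIntegral_rieszKernel_annulus, zero_mul, zero_add]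
    · rw [Set.disjoint_left]
      intro y hy hy'
      exact absurd hy.2 (not_lt.2 hy')
  have hlim : Tendsto (fun ε => rieszTruncated j ε f x) (𝓝[>] (0 : ℝ))
      (𝓝 (∫ y in {y | r ≤ ‖y‖}, rieszKernel j y * f (x - y))) := by
    refine tendsto_const_nhds.congr' ?_
    filter_upwards [Ioo_mem_nhdsGT hr] with ε hε using (hT ε hε).symm
  exact ⟨⟨hlt, _, hlim⟩, hlim.limUnder_eq⟩

lemma integrable_riesz_tail (n : ℕ) :
    Integrable fun y : EuclideanSpace ℝ (Fin n) => (1 + ‖y‖) ^ (-((n : ℝ) + 1)) :=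
  integrable_one_add_norm (by simp)

lemma integral_scaled_tail {δ : ℝ} (hδ : 0 < δ) :
    Integrable (fun y : EuclideanSpace ℝ (Fin n) => δ / (δ + ‖y‖) ^ (n + 1)) ∧
    ∫ y : EuclideanSpace ℝ (Fin n), δ / (δ + ‖y‖) ^ (n + 1) =
      ∫ y : EuclideanSpace ℝ (Fin n), (1 + ‖y‖) ^ (-((n : ℝ) + 1)) := by
  have key : (fun y : EuclideanSpace ℝ (Fin n) => δ / (δ + ‖y‖) ^ (n + 1)) =
      fun y => (δ⁻¹) ^ n * (fun y : EuclideanSpace ℝ (Fin n) =>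
        (1 + ‖y‖) ^ (-((n : ℝ) + 1))) (δ⁻¹ • y) := by
    ext y
    have h0 : 0 ≤ ‖y‖ := norm_nonneg y
    have h1 : ‖δ⁻¹ • y‖ = δ⁻¹ * ‖y‖ := by rw [norm_smul, Real.norm_of_nonneg (by positivity)]
    have h2 : (1 + δ⁻¹ * ‖y‖) = (δ + ‖y‖) / δ := by field_simp
    have h3 : ((n : ℝ) + 1) = ((n + 1 : ℕ) : ℝ) := by push_cast; ring
    simp only [h1, h2]
    rw [Real.rpow_neg (by positivity), h3, Real.rpow_natCast, div_pow]
    field_simp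
    simp [pow_succ]
    field_simp
  rw [key]
  refine ⟨((integrable_riesz_tail n).comp_smul (by positivity)).const_mul _, ?_⟩
  rw [integral_const_mul, Measure.integral_comp_smul volume
    (fun y : EuclideanSpace ℝ (Fin n) => (1 + ‖y‖) ^ (-((n : ℝ) + 1)))]
  simp only [finrank_euclideanSpace, Fintype.card_fin, smul_eq_mul]
  rw [← mul_assoc, abs_of_nonneg (by positivity)]
  have : δ⁻¹ ^ n * ((δ⁻¹) ^ n)⁻¹ = 1 := mul_inv_cancel₀ (by positivity)
  rw [this, one_mul]

/-- The weak singularity `|y| ^ (θ - n)` is integrable on balls. -/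
lemma integrableOn_weak_singularity [NeZero n] {θ : ℝ} (hθ : 0 < θ) (R : ℝ) :
    IntegrableOn (fun y : EuclideanSpace ℝ (Fin n) => ‖y‖ ^ (θ - n)) (Metric.ball 0 R) := by
  rcases le_or_gt R 0 with hR | hR
  · simp [Metric.ball_eq_empty.2 hR]
  refine (integrableOn_fun_norm_addHaar (μ := volume)
    (f := fun t : ℝ => t ^ (θ - n))).2 ?_
  have h1 : IntegrableOn (fun t : ℝ => t ^ (θ - 1)) (Set.Ioo 0 R) :=
    (intervalIntegral.integrableOn_Ioo_rpow_iff hR).2 (by linarith)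
  refine h1.congr_fun (fun t ht => ?_) measurableSet_Ioo
  have hn : 1 ≤ n := NeZero.one_le
  simp only [finrank_euclideanSpace, Fintype.card_fin, smul_eq_mul]
  rw [← Real.rpow_natCast, ← Real.rpow_add ht.1]
  congr 1
  push_cast [hn]
  ring

lemma setIntegral_weak_singularity {θ δ : ℝ} (hδ : 0 < δ) :
    ∫ y in Metric.ball (0 : EuclideanSpace ℝ (Fin n)) δ, ‖y‖ ^ (θ - n) =
      δ ^ θ * ∫ y in Metric.ball (0 : EuclideanSpace ℝ (Fin n)) 1, ‖y‖ ^ (θ - n) := by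
  have h := Measure.setIntegral_comp_smul_of_pos (volume : Measure (EuclideanSpace ℝ (Fin n)))
    (fun y => ‖y‖ ^ (θ - n)) (Metric.ball 0 1) hδ
  rw [smul_unitBall_of_pos hδ] at h
  simp only [finrank_euclideanSpace, Fintype.card_fin, smul_eq_mul, norm_smul,
    Real.norm_of_nonneg hδ.le] at h
  simp_rw [Real.mul_rpow hδ.le (norm_nonneg _)] at h
  rw [integral_const_mul] at h
  rw [← mul_right_inj' (by positivity : (δ ^ n)⁻¹ ≠ 0), ← h, ← mul_assoc]
  congr 1
  rw [Real.rpow_sub hδ, Real.rpow_natCast]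
  field_simp

/-! ### Pointwise bounds for Riesz transforms of differences -/

/-- The Riesz kernel cut off to the complement of the ball of radius `ρ`. -/
def rieszKernelTail (j : Fin n) (ρ : ℝ) : EuclideanSpace ℝ (Fin n) → ℝ :=
  {y | ρ ≤ ‖y‖}.indicator (rieszKernel j)

lemma rieszKernelTail_of_le {j : Fin n} {ρ : ℝ} {y : EuclideanSpace ℝ (Fin n)} (h : ρ ≤ ‖y‖) :
    rieszKernelTail j ρ y = rieszKernel j y :=
  Set.indicator_of_mem (s := {y | ρ ≤ ‖y‖}) h _

lemma measurable_rieszKernelTail (j : Fin n) (ρ : ℝ) : Measurable (rieszKernelTail j ρ) :=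
  (measurable_rieszKernel j).indicator (measurableSet_norm_le ρ)

lemma abs_rieszKernelTail_le (j : Fin n) {ρ : ℝ} (hρ : 0 < ρ) (y : EuclideanSpace ℝ (Fin n)) :
    |rieszKernelTail j ρ y| ≤ rieszConst n / ρ ^ n := by
  have := rieszConst_nonneg n
  by_cases h : ρ ≤ ‖y‖
  · rw [rieszKernelTail_of_le h]
    refine (abs_rieszKernel_le j y).trans ?_
    gcongr
  · rw [rieszKernelTail, Set.indicator_of_notMem (by exact h)]
    simp only [abs_zero]
    positivity

lemma integrable_rieszKernelTail_mul (j : Fin n) {ρ : ℝ} (hρ : 0 < ρ)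
    {g : EuclideanSpace ℝ (Fin n) → ℝ} (hg : Integrable g) (v : EuclideanSpace ℝ (Fin n)) :
    Integrable fun y => rieszKernelTail j ρ (y - v) * g y := by
  refine Integrable.bdd_mul (c := rieszConst n / ρ ^ n) hg
    ((measurable_rieszKernelTail j ρ).comp (measurable_id.sub_const v)).aestronglyMeasurable
    (.of_forall fun y => abs_rieszKernelTail_le j hρ _)

/-- Summation by parts: a difference structure of `f` is moved onto the kernel. -/
lemma setIntegral_rieszKernel_shift (j : Fin n) {ρ : ℝ} (hρ : 0 < ρ)
    {f g : EuclideanSpace ℝ (Fin n) → ℝ} (hg : Integrable g) {v : EuclideanSpace ℝ (Fin n)}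
    (hf : ∀ y, f y = g y - g (y - v)) (x : EuclideanSpace ℝ (Fin n)) :
    ∫ y in {y | ρ ≤ ‖y‖}, rieszKernel j y * f (x - y) =
      ∫ y, (rieszKernelTail j ρ y - rieszKernelTail j ρ (y - v)) * g (x - y) := by
  have hgx := hg.comp_sub_left x
  have h0 : Integrable fun y => rieszKernelTail j ρ y * g (x - y) := by
    simpa using integrable_rieszKernelTail_mul j hρ hgx 0
  have h1 : Integrable fun y => rieszKernelTail j ρ y * g (x - y - v) := by
    have := integrable_rieszKernelTail_mul j hρ (hg.comp_sub_left (x - v)) 0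
    simpa [sub_right_comm] using this
  have e1 : ∫ y in {y | ρ ≤ ‖y‖}, rieszKernel j y * f (x - y) =
      ∫ y, (rieszKernelTail j ρ y * g (x - y) - rieszKernelTail j ρ y * g (x - y - v)) := by
    rw [← integral_indicator (measurableSet_norm_le ρ)]
    congr 1
    ext y
    rw [← mul_sub, ← hf, rieszKernelTail]
    exact Set.indicator_mul_left _ _ _
  have e2 : ∫ y, rieszKernelTail j ρ y * g (x - y - v) =
      ∫ y, rieszKernelTail j ρ (y - v) * g (x - y) := by
    rw [← integral_sub_right_eq_self _ v]
    congr 1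
    ext y
    congr 2
    abel
  simp_rw [sub_mul]
  rw [e1, integral_sub h0 h1, integral_sub h0 (integrable_rieszKernelTail_mul j hρ hgx v), e2]

/-- The constant in the bound for the differenced truncated kernel. -/
def rieszTailConst (n : ℕ) : ℝ := (2 * rieszConst n + rieszSmoothConst n) * 4 ^ (n + 1)

lemma rieszTailConst_nonneg (n : ℕ) : 0 ≤ rieszTailConst n := by
  have := rieszConst_nonneg n
  have := rieszSmoothConst_nonneg n
  unfold rieszTailConst
  positivity

lemma abs_rieszKernelTail_sub_le (j : Fin n) {v : EuclideanSpace ℝ (Fin n)} (hv : v ≠ 0)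
    (y : EuclideanSpace ℝ (Fin n)) :
    |rieszKernelTail j (2 * ‖v‖) y - rieszKernelTail j (2 * ‖v‖) (y - v)| ≤
      rieszTailConst n * (‖v‖ / (‖v‖ + ‖y‖) ^ (n + 1)) := by
  have hδ : 0 < ‖v‖ := norm_pos_iff.2 hv
  have hc := rieszConst_nonneg n
  have hs := rieszSmoothConst_nonneg n
  have h0 := norm_nonneg y
  rcases le_or_gt (3 * ‖v‖) ‖y‖ with h | h
  · have h1 : 2 * ‖v‖ ≤ ‖y‖ := by linarith
    have h2 : 2 * ‖v‖ ≤ ‖y - v‖ := by have := norm_sub_norm_le y v; linarith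
    rw [rieszKernelTail_of_le h1, rieszKernelTail_of_le h2]
    refine (abs_rieszKernel_sub_le j h1).trans ?_
    have hy : 0 < ‖y‖ := by linarith
    have h3 : ‖v‖ / ‖y‖ ^ (n + 1) ≤ 4 ^ (n + 1) * (‖v‖ / (‖v‖ + ‖y‖) ^ (n + 1)) := by
      rw [mul_div_assoc', div_le_div_iff₀ (by positivity) (by positivity)]
      have : (‖v‖ + ‖y‖) ^ (n + 1) ≤ 4 ^ (n + 1) * ‖y‖ ^ (n + 1) := by
        rw [← mul_pow]
        exact pow_le_pow_left₀ (by positivity) (by linarith) _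
      nlinarith
    calc rieszSmoothConst n * (‖v‖ / ‖y‖ ^ (n + 1))
        ≤ (2 * rieszConst n + rieszSmoothConst n) *
            (4 ^ (n + 1) * (‖v‖ / (‖v‖ + ‖y‖) ^ (n + 1))) := by
          gcongr
          linarith
      _ = _ := by rw [rieszTailConst]; ring
  · have h2 : (0 : ℝ) < 2 * ‖v‖ := by positivity
    refine (abs_sub _ _).trans ((add_le_add (abs_rieszKernelTail_le j h2 _)
      (abs_rieszKernelTail_le j h2 _)).trans ?_)
    have h3 : 1 / (2 * ‖v‖) ^ n ≤ 4 ^ (n + 1) * (‖v‖ / (‖v‖ + ‖y‖) ^ (n + 1)) := by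
      rw [mul_div_assoc', div_le_div_iff₀ (by positivity) (by positivity)]
      have e1 : (‖v‖ + ‖y‖) ^ (n + 1) ≤ (4 * ‖v‖) ^ (n + 1) :=
        pow_le_pow_left₀ (by positivity) (by linarith) _
      have e2 : ‖v‖ ^ n ≤ (2 * ‖v‖) ^ n := pow_le_pow_left₀ hδ.le (by linarith) _
      calc 1 * (‖v‖ + ‖y‖) ^ (n + 1) ≤ (4 * ‖v‖) ^ (n + 1) := by linarith
        _ = 4 ^ (n + 1) * ‖v‖ * ‖v‖ ^ n := by rw [mul_pow, pow_succ ‖v‖]; ring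
        _ ≤ _ := by gcongr
    calc rieszConst n / (2 * ‖v‖) ^ n + rieszConst n / (2 * ‖v‖) ^ n
        = (2 * rieszConst n) * (1 / (2 * ‖v‖) ^ n) := by ring
      _ ≤ (2 * rieszConst n + rieszSmoothConst n) *
            (4 ^ (n + 1) * (‖v‖ / (‖v‖ + ‖y‖) ^ (n + 1))) := by
          gcongr
          linarith
      _ = _ := by rw [rieszTailConst]; ring

/-- The part of the Riesz integral at distances above the oscillation scale `‖v‖` is bounded
independently of the scale. -/
lemma abs_setIntegral_rieszKernel_tail_le (j : Fin n) {f g : EuclideanSpace ℝ (Fin n) → ℝ}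
    (hg : Integrable g) (hg1 : ∀ y, |g y| ≤ 1) {v : EuclideanSpace ℝ (Fin n)} (hv : v ≠ 0)
    (hf : ∀ y, f y = g y - g (y - v)) (x : EuclideanSpace ℝ (Fin n)) :
    |∫ y in {y | 2 * ‖v‖ ≤ ‖y‖}, rieszKernel j y * f (x - y)| ≤
      rieszTailConst n * ∫ y : EuclideanSpace ℝ (Fin n), (1 + ‖y‖) ^ (-((n : ℝ) + 1)) := by
  have hδ : 0 < ‖v‖ := norm_pos_iff.2 hv
  rw [setIntegral_rieszKernel_shift j (by positivity) hg hf, ← (integral_scaled_tail hδ).2,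
    ← integral_const_mul, ← Real.norm_eq_abs]
  refine norm_integral_le_of_norm_le ((integral_scaled_tail hδ).1.const_mul _)
    (.of_forall fun y => ?_)
  rw [Real.norm_eq_abs, abs_mul]
  exact (mul_le_of_le_one_right (abs_nonneg _) (hg1 _)).trans (abs_rieszKernelTail_sub_le j hv y)

/-- Trading the critical singularity `‖y‖ ^ (-n)` for a weak one costs a power of the distance. -/
lemma one_div_norm_pow_le {θ r : ℝ} (hθ : 0 ≤ θ) (hr : 0 < r) {y : EuclideanSpace ℝ (Fin n)}
    (hy : r ≤ ‖y‖) : 1 / ‖y‖ ^ n ≤ r ^ (-θ) * ‖y‖ ^ (θ - n) := by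
  have hy0 : 0 < ‖y‖ := hr.trans_le hy
  have h1 : 1 / ‖y‖ ^ n = ‖y‖ ^ (-θ) * ‖y‖ ^ (θ - n) := by
    rw [← Real.rpow_add hy0, ← Real.rpow_natCast, one_div, ← Real.rpow_neg hy0.le]
    congr 1
    ring
  rw [h1]
  gcongr ?_ * _
  exact Real.rpow_le_rpow_of_nonpos hr hy (by linarith)

lemma setIntegral_rieszKernel_near_le [NeZero n] (j : Fin n) {F : EuclideanSpace ℝ (Fin n) → ℝ}
    {θ r R M : ℝ} (hθ : 0 < θ) (hr : 0 < r) (hM : 0 ≤ M) (hF : ∀ y, |F y| ≤ M) :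
    |∫ y in {y | r ≤ ‖y‖ ∧ ‖y‖ < R}, rieszKernel j y * F y| ≤
      M * rieszConst n * r ^ (-θ) *
        ∫ y in Metric.ball (0 : EuclideanSpace ℝ (Fin n)) R, ‖y‖ ^ (θ - n) := by
  have hc := rieszConst_nonneg n
  have hm : MeasurableSet {y : EuclideanSpace ℝ (Fin n) | r ≤ ‖y‖ ∧ ‖y‖ < R} :=
    (measurableSet_norm_le r).inter (measurableSet_lt measurable_norm measurable_const)
  have hsub : {y : EuclideanSpace ℝ (Fin n) | r ≤ ‖y‖ ∧ ‖y‖ < R} ⊆ Metric.ball 0 R :=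
    fun y hy => by simpa using hy.2
  have hI : IntegrableOn (fun y : EuclideanSpace ℝ (Fin n) =>
      M * rieszConst n * r ^ (-θ) * ‖y‖ ^ (θ - n)) (Metric.ball 0 R) :=
    (integrableOn_weak_singularity (n := n) hθ R).const_mul _
  rw [← Real.norm_eq_abs, ← integral_const_mul]
  refine (norm_integral_le_of_norm_le (hI.mono_set hsub) ?_).trans
    (setIntegral_mono_set hI (.of_forall fun y => by positivity) (.of_forall hsub))
  filter_upwards [ae_restrict_mem hm] with y hy
  rw [Real.norm_eq_abs, abs_mul]
  have h1 := abs_rieszKernel_le j y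
  have h2 := one_div_norm_pow_le hθ.le hr hy.1
  calc |rieszKernel j y| * |F y| ≤ rieszConst n / ‖y‖ ^ n * M := by
        gcongr
        exact hF y
    _ = M * rieszConst n * (1 / ‖y‖ ^ n) := by ring
    _ ≤ M * rieszConst n * (r ^ (-θ) * ‖y‖ ^ (θ - n)) := by gcongr
    _ = _ := by ring

/-- Pointwise bound for the Riesz transform of a function oscillating at the scale `‖v‖`, at a
point near which the function is constant. The bound depends only on the ratio of the scales. -/
lemma exists_abs_rieszTransform_le_of_const_near [NeZero n] {θ : ℝ} (hθ : 0 < θ) :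
    ∃ C : ℝ, 0 ≤ C ∧ ∀ (j : Fin n) (f g : EuclideanSpace ℝ (Fin n) → ℝ)
      (v x : EuclideanSpace ℝ (Fin n)) (r : ℝ), Integrable g → (∀ y, |g y| ≤ 1) →
      (∀ y, f y = g y - g (y - v)) → 0 < r → r ≤ ‖v‖ → (∀ y, ‖y‖ < r → f (x - y) = f x) →
      |rieszTransform j f x| ≤ C * (‖v‖ / r) ^ θ := by
  obtain ⟨S, hS⟩ : ∃ S, ∫ y in Metric.ball (0 : EuclideanSpace ℝ (Fin n)) 1, ‖y‖ ^ (θ - n) = S :=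
    ⟨_, rfl⟩
  obtain ⟨A, hA⟩ : ∃ A, ∫ y : EuclideanSpace ℝ (Fin n), (1 + ‖y‖) ^ (-((n : ℝ) + 1)) = A :=
    ⟨_, rfl⟩
  have hS0 : 0 ≤ S := hS ▸ integral_nonneg fun y => by positivity
  have hA0 : 0 ≤ A := hA ▸ integral_nonneg fun y => by positivity
  have hc := rieszConst_nonneg n
  have ht := rieszTailConst_nonneg n
  refine ⟨2 * rieszConst n * 2 ^ θ * S + rieszTailConst n * A, by positivity, ?_⟩
  intro j f g v x r hg hg1 hf hr hrv hx
  have hδ : 0 < ‖v‖ := hr.trans_le hrv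
  have hv : v ≠ 0 := norm_pos_iff.1 hδ
  have hfi : Integrable f := by
    have : f = fun y => g y - g (y - v) := funext hf
    rw [this]
    exact hg.sub (hg.comp_sub_right v)
  have hf2 : ∀ y, |f y| ≤ 2 := fun y => by
    rw [hf]
    exact (abs_sub _ _).trans (by linarith [hg1 y, hg1 (y - v)])
  rw [(rieszTransform_of_const_near j hfi hr hx).2]
  have hset : {y : EuclideanSpace ℝ (Fin n) | r ≤ ‖y‖} =
      {y | r ≤ ‖y‖ ∧ ‖y‖ < 2 * ‖v‖} ∪ {y | 2 * ‖v‖ ≤ ‖y‖} := by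
    ext y
    simp only [Set.mem_ofPred_eq, Set.mem_union]
    constructor
    · intro h
      rcases lt_or_ge ‖y‖ (2 * ‖v‖) with h' | h'
      · exact Or.inl ⟨h, h'⟩
      · exact Or.inr h'
    · rintro (h | h)
      · exact h.1
      · linarith
  have hi := integrableOn_rieszKernel_mul j hfi x hr
  rw [hset, setIntegral_union _ (measurableSet_norm_le _) (hi.mono_set fun y hy => hy.1)
    (hi.mono_set fun y (hy : 2 * ‖v‖ ≤ ‖y‖) => (by linarith : r ≤ ‖y‖))]
  · have h1 := setIntegral_rieszKernel_near_le j (F := fun y => f (x - y)) (R := 2 * ‖v‖) hθ hr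
      zero_le_two (fun y => hf2 _)
    have h2 := abs_setIntegral_rieszKernel_tail_le j hg hg1 hv hf x
    rw [setIntegral_weak_singularity (by positivity), Real.mul_rpow zero_le_two hδ.le, hS] at h1
    rw [hA] at h2
    have h3 : r ^ (-θ) * ‖v‖ ^ θ = (‖v‖ / r) ^ θ := by
      rw [Real.div_rpow hδ.le hr.le, Real.rpow_neg hr.le]
      field_simp
    have h4 : 1 ≤ (‖v‖ / r) ^ θ := Real.one_le_rpow ((one_le_div hr).2 hrv) hθ.le
    refine (abs_add_le _ _).trans ((add_le_add h1 h2).trans ?_)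
    calc 2 * rieszConst n * r ^ (-θ) * (2 ^ θ * ‖v‖ ^ θ * S) + rieszTailConst n * A
        = 2 * rieszConst n * 2 ^ θ * S * (r ^ (-θ) * ‖v‖ ^ θ) + rieszTailConst n * A * 1 := by ring
      _ ≤ 2 * rieszConst n * 2 ^ θ * S * (‖v‖ / r) ^ θ
          + rieszTailConst n * A * (‖v‖ / r) ^ θ := by rw [h3]; gcongr
      _ = _ := by ring
  · rw [Set.disjoint_left]
    intro y hy hy'
    exact absurd hy.2 (not_lt.2 hy')

/-- Off the support of `g` the differenced kernel is regular. -/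
lemma abs_tail_sub_mul_le (j : Fin n) {g : EuclideanSpace ℝ (Fin n) → ℝ}
    {v x y : EuclideanSpace ℝ (Fin n)} {r : ℝ} (hr : 2 * ‖v‖ ≤ r)
    (hx : ∀ y, ‖y‖ < r → g (x - y) = 0 ∧ g (x - y - v) = 0) :
    |(rieszKernelTail j r y - rieszKernelTail j r (y - v)) * g (x - y)| ≤
      {y | r ≤ ‖y‖}.indicator (fun y => rieszSmoothConst n * (‖v‖ / ‖y‖ ^ (n + 1))) y
        * |g (x - y)| := by
  by_cases h0 : g (x - y) = 0
  · simp [h0]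
  -- Where `g (x - y) ≠ 0`, neither cutoff is active.
  have h1 : r ≤ ‖y‖ := by
    by_contra! h
    exact h0 (hx y h).1
  have h2 : r ≤ ‖y - v‖ := by
    by_contra! h
    refine h0 ?_
    have := (hx _ h).2
    rwa [show x - (y - v) - v = x - y by abel] at this
  rw [rieszKernelTail_of_le h1, rieszKernelTail_of_le h2, abs_mul,
    Set.indicator_of_mem (s := {y | r ≤ ‖y‖}) h1]
  exact mul_le_mul_of_nonneg_right (abs_rieszKernel_sub_le j (hr.trans h1)) (abs_nonneg _)

/-- Off the support of an oscillating function, its Riesz transform decays with the scale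
`‖v‖` of the oscillation, locally with a weakly singular factor at the boundary. -/
lemma exists_abs_rieszTransform_le_off_support [NeZero n] {θ : ℝ} (hθ : 0 < θ) (hθ1 : θ ≤ 1)
    (R : ℝ) :
    ∃ C : ℝ, 0 ≤ C ∧ ∀ (j : Fin n) (f g : EuclideanSpace ℝ (Fin n) → ℝ)
      (v x : EuclideanSpace ℝ (Fin n)) (r : ℝ), Integrable g → (∀ y, |g y| ≤ 1) →
      (∀ y, f y = g y - g (y - v)) → v ≠ 0 → 0 < r →
      (∀ y, R ≤ ‖y‖ → g y = 0 ∧ g (y - v) = 0) → ‖x‖ ≤ R →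
      (∀ y, ‖y‖ < r → g (x - y) = 0 ∧ g (x - y - v) = 0) →
      |rieszTransform j f x| ≤ C * ‖v‖ ^ θ * r ^ (-(2 * θ)) := by
  obtain ⟨S, hS⟩ :
      ∃ S, ∫ y in Metric.ball (0 : EuclideanSpace ℝ (Fin n)) (2 * R), ‖y‖ ^ (θ - n) = S := ⟨_, rfl⟩
  have hS0 : 0 ≤ S := hS ▸ integral_nonneg fun y => by positivity
  have hc := rieszConst_nonneg n
  have hs := rieszSmoothConst_nonneg n
  refine ⟨2 * rieszConst n * 2 ^ θ * S + rieszSmoothConst n * S, by positivity, ?_⟩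
  intro j f g v x r hg hg1 hf hv hr hR hxR hx
  have hδ : 0 < ‖v‖ := norm_pos_iff.2 hv
  have hfi : Integrable f := by
    have : f = fun y => g y - g (y - v) := funext hf
    rw [this]
    exact hg.sub (hg.comp_sub_right v)
  have hf2 : ∀ y, |f y| ≤ 2 := fun y => by
    rw [hf]
    exact (abs_sub _ _).trans (by linarith [hg1 y, hg1 (y - v)])
  have hf0 : ∀ y, ‖y‖ < r → f (x - y) = 0 := fun y hy => by rw [hf, (hx y hy).1, (hx y hy).2]; simp
  have hfar : ∀ y, 2 * R ≤ ‖y‖ → R ≤ ‖x - y‖ := fun y hy => by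
    have := norm_sub_norm_le y x
    rw [norm_sub_rev] at this
    linarith
  rw [(rieszTransform_of_const_near j hfi hr fun y hy => by
    rw [hf0 y hy, ← hf0 0 (by simpa using hr), sub_zero]).2]
  have hr2 : r ^ (-θ) = r ^ θ * r ^ (-(2 * θ)) := by
    rw [← Real.rpow_add hr]; congr 1; ring
  -- Up to the scale of the oscillation size estimates suffice; beyond it cancellation is needed.
  rcases lt_or_ge r (2 * ‖v‖) with hrv | hrv
  · have hset : ∫ y in {y | r ≤ ‖y‖}, rieszKernel j y * f (x - y) =
        ∫ y in {y | r ≤ ‖y‖ ∧ ‖y‖ < 2 * R}, rieszKernel j y * f (x - y) := by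
      refine setIntegral_eq_of_subset_of_forall_sdiff_eq_zero (measurableSet_norm_le r)
        (fun y hy => hy.1) fun y hy => ?_
      have : R ≤ ‖x - y‖ := hfar y (not_lt.1 fun h => hy.2 ⟨hy.1, h⟩)
      rw [hf, (hR _ this).1, (hR _ this).2]
      simp
    rw [hset]
    refine (setIntegral_rieszKernel_near_le j (F := fun y => f (x - y)) (R := 2 * R) hθ hr
      zero_le_two (fun y => hf2 _)).trans ?_
    rw [hS]
    have h1 : r ^ θ ≤ 2 ^ θ * ‖v‖ ^ θ := by
      rw [← Real.mul_rpow zero_le_two hδ.le]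
      exact Real.rpow_le_rpow hr.le hrv.le hθ.le
    calc 2 * rieszConst n * r ^ (-θ) * S
        ≤ 2 * rieszConst n * ((2 ^ θ * ‖v‖ ^ θ) * r ^ (-(2 * θ))) * S := by rw [hr2]; gcongr
      _ = 2 * rieszConst n * 2 ^ θ * S * (‖v‖ ^ θ * r ^ (-(2 * θ))) := by ring
      _ ≤ (2 * rieszConst n * 2 ^ θ * S + rieszSmoothConst n * S) *
          (‖v‖ ^ θ * r ^ (-(2 * θ))) := by
        gcongr
        exact le_add_of_nonneg_right (by positivity)
      _ = _ := by ring
  · rw [setIntegral_rieszKernel_shift j hr hg hf]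
    set D := rieszSmoothConst n * (‖v‖ ^ θ * r ^ (-(2 * θ))) with hD
    have hbd : ∀ y, ‖(rieszKernelTail j r y - rieszKernelTail j r (y - v)) * g (x - y)‖ ≤
        (Metric.ball (0 : EuclideanSpace ℝ (Fin n)) (2 * R)).indicator
          (fun y => D * ‖y‖ ^ (θ - n)) y := by
      intro y
      by_cases h0 : g (x - y) = 0
      · rw [h0, mul_zero, norm_zero]
        exact Set.indicator_nonneg (fun y _ => by positivity) y
      refine (abs_tail_sub_mul_le j hrv hx).trans ?_
      have hyR : y ∈ Metric.ball (0 : EuclideanSpace ℝ (Fin n)) (2 * R) := by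
        rw [mem_ball_zero_iff]
        by_contra! h
        exact h0 (hR _ (hfar y h)).1
      have hry : r ≤ ‖y‖ := by
        by_contra! h
        exact h0 (hx y h).1
      have hy0 : 0 < ‖y‖ := hr.trans_le hry
      rw [Set.indicator_of_mem hyR, Set.indicator_of_mem (s := {y | r ≤ ‖y‖}) hry]
      refine (mul_le_of_le_one_right (by positivity) (hg1 _)).trans ?_
      rw [hD, mul_assoc]
      gcongr ?_ * ?_
      have e1 : ‖v‖ / ‖y‖ ^ (n + 1) = ‖v‖ ^ θ * (‖v‖ ^ (1 - θ) * ‖y‖ ^ (-((n : ℝ) + 1))) := by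
        rw [← mul_assoc, ← Real.rpow_add hδ, add_sub_cancel, Real.rpow_one, Real.rpow_neg hy0.le]
        rw [show (n : ℝ) + 1 = ((n + 1 : ℕ) : ℝ) by push_cast; ring, Real.rpow_natCast]
        rfl
      have e2 : ‖v‖ ^ (1 - θ) ≤ ‖y‖ ^ (1 - θ) :=
        Real.rpow_le_rpow hδ.le (by linarith) (by linarith)
      have e3 : ‖y‖ ^ (1 - θ) * ‖y‖ ^ (-((n : ℝ) + 1)) = ‖y‖ ^ (-(2 * θ)) * ‖y‖ ^ (θ - n) := by
        rw [← Real.rpow_add hy0, ← Real.rpow_add hy0]; congr 1; ring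
      have e4 : ‖y‖ ^ (-(2 * θ)) ≤ r ^ (-(2 * θ)) :=
        Real.rpow_le_rpow_of_nonpos hr hry (by linarith)
      rw [e1, mul_assoc]
      gcongr ?_ * ?_
      calc ‖v‖ ^ (1 - θ) * ‖y‖ ^ (-((n : ℝ) + 1)) ≤ ‖y‖ ^ (1 - θ) * ‖y‖ ^ (-((n : ℝ) + 1)) := by
            gcongr
        _ = _ := e3
        _ ≤ _ := by gcongr
    have hI := (integrableOn_weak_singularity (n := n) hθ (2 * R)).const_mul D
    have := norm_integral_le_of_norm_le ((integrable_indicator_iff measurableSet_ball).2 hI)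
      (.of_forall hbd)
    rw [integral_indicator measurableSet_ball, integral_const_mul, Real.norm_eq_abs, hS] at this
    refine this.trans ?_
    calc D * S = rieszSmoothConst n * S * (‖v‖ ^ θ * r ^ (-(2 * θ))) := by rw [hD]; ring
      _ ≤ (2 * rieszConst n * 2 ^ θ * S + rieszSmoothConst n * S) *
          (‖v‖ ^ θ * r ^ (-(2 * θ))) := by
        gcongr
        exact le_add_of_nonneg_left (by positivity)
      _ = _ := by ring

/-- Decay at infinity of the Riesz transform of an oscillating function. -/
lemma exists_abs_rieszTransform_le_far {R : ℝ} (hR0 : 0 < R) :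
    ∃ C : ℝ, 0 ≤ C ∧ ∀ (j : Fin n) (f g : EuclideanSpace ℝ (Fin n) → ℝ)
      (v x : EuclideanSpace ℝ (Fin n)), Integrable g → (∀ y, |g y| ≤ 1) →
      (∀ y, f y = g y - g (y - v)) → 2 * ‖v‖ ≤ R →
      (∀ y, R ≤ ‖y‖ → g y = 0 ∧ g (y - v) = 0) → 2 * R ≤ ‖x‖ →
      |rieszTransform j f x| ≤ C * ‖v‖ / ‖x‖ ^ (n + 1) := by
  set V := volume.real (Metric.ball (0 : EuclideanSpace ℝ (Fin n)) R) with hV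
  have hs := rieszSmoothConst_nonneg n
  refine ⟨rieszSmoothConst n * 2 ^ (n + 1) * V, by positivity, ?_⟩
  intro j f g v x hg hg1 hf hv hR hx
  have hx0 : 0 < ‖x‖ := by linarith
  set r := ‖x‖ / 2 with hr
  have hr0 : 0 < r := by positivity
  have hfi : Integrable f := by
    have : f = fun y => g y - g (y - v) := funext hf
    rw [this]
    exact hg.sub (hg.comp_sub_right v)
  have hxg : ∀ y, ‖y‖ < r → g (x - y) = 0 ∧ g (x - y - v) = 0 := fun y hy => by
    refine hR _ ?_
    have := norm_sub_norm_le x y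
    linarith
  have hf0 : ∀ y, ‖y‖ < r → f (x - y) = 0 := fun y hy => by
    rw [hf, (hxg y hy).1, (hxg y hy).2]; simp
  rw [(rieszTransform_of_const_near j hfi hr0 fun y hy => by
    rw [hf0 y hy, ← hf0 0 (by simpa using hr0), sub_zero]).2,
    setIntegral_rieszKernel_shift j hr0 hg hf]
  set D := rieszSmoothConst n * (‖v‖ / r ^ (n + 1)) with hD
  have hbd : ∀ y, ‖(rieszKernelTail j r y - rieszKernelTail j r (y - v)) * g (x - y)‖ ≤
      D * |g (x - y)| := by
    intro y
    refine (abs_tail_sub_mul_le j (by linarith) hxg).trans ?_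
    gcongr
    refine Set.indicator_apply_le' (fun hy => ?_) (fun _ => by positivity)
    have hy : r ≤ ‖y‖ := hy
    rw [hD]
    gcongr
  have hgabs : ∫ y, |g (x - y)| ≤ V := by
    rw [integral_sub_left_eq_self (fun y => |g y|) volume x, hV,
      ← integral_indicator_one measurableSet_ball]
    refine integral_mono hg.abs ((integrable_indicator_iff measurableSet_ball).2
      (integrableOn_const measure_ball_lt_top.ne)) fun y => ?_
    by_cases hy : y ∈ Metric.ball (0 : EuclideanSpace ℝ (Fin n)) R
    · simpa [hy] using hg1 y
    · rw [mem_ball_zero_iff, not_lt] at hy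
      simp [(hR y hy).1, not_lt.2 hy]
  have := norm_integral_le_of_norm_le ((hg.comp_sub_left x).abs.const_mul D) (.of_forall hbd)
  rw [integral_const_mul, Real.norm_eq_abs] at this
  refine this.trans ?_
  calc D * ∫ y, |g (x - y)| ≤ D * V := by gcongr
    _ = _ := by rw [hD, hr, div_pow]; field_simp

/-! ### Oscillations on boxes -/

/-- The half-open box `∏ i, [c i, c i + s i)`. -/
def halfOpenBox (c s : Fin n → ℝ) : Set (EuclideanSpace ℝ (Fin n)) :=
  {x | ∀ i, x i ∈ Set.Ico (c i) (c i + s i)}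

/-- The cylinder over the face `∏ i ≠ 0, [c i, c i + s i)` of a box. -/
def boxCylinder [NeZero n] (c s : Fin n → ℝ) : Set (EuclideanSpace ℝ (Fin n)) :=
  {x | ∀ i, i ≠ 0 → x i ∈ Set.Ico (c i) (c i + s i)}

/-- The horizontal oscillation on a box: in the first coordinate, the sum of the Haar functions of
the `N` intervals of length `s 0 / N` into which `[c 0, c 0 + s 0)` is divided. -/
def boxOsc [NeZero n] (c s : Fin n → ℝ) (N : ℕ) (x : EuclideanSpace ℝ (Fin n)) : ℝ :=
  (∑ i ∈ Finset.range N, haarSign (c 0 + i * (s 0 / N)) (s 0 / N) (x 0)) *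
    (boxCylinder c s).indicator 1 x

/-- The positive part of `boxOsc`. -/
def boxOscPos [NeZero n] (c s : Fin n → ℝ) (N : ℕ) (x : EuclideanSpace ℝ (Fin n)) : ℝ :=
  (∑ i ∈ Finset.range N, (Set.Ico (c 0 + i * (s 0 / N))
    (c 0 + i * (s 0 / N) + s 0 / N / 2)).indicator 1 (x 0)) * (boxCylinder c s).indicator 1 x

/-- The translation vector carrying the positive part of `boxOsc` to its negative part. -/
def halfStep [NeZero n] (s : Fin n → ℝ) (N : ℕ) : EuclideanSpace ℝ (Fin n) :=
  EuclideanSpace.single 0 (s 0 / N / 2)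

lemma alternatingHorizontal_eq_boxOsc [NeZero n] (Q : Cube n) (k : ℕ) :
    alternatingHorizontal Q k = boxOsc Q.corner (fun _ => Q.side) (2 ^ (k - 1)) := by
  ext x
  simp only [alternatingHorizontal, alternating, boxOsc, boxCylinder]
  push_cast
  rfl

lemma norm_halfStep [NeZero n] {s : Fin n → ℝ} (hs : 0 ≤ s 0) (N : ℕ) :
    ‖halfStep s N‖ = s 0 / N / 2 := by
  rw [halfStep, PiLp.norm_single, Real.norm_of_nonneg (by positivity)]

lemma mem_Ico_sub_iff {u v t d : ℝ} : t - d ∈ Set.Ico u v ↔ t ∈ Set.Ico (u + d) (v + d) := by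
  simp only [Set.mem_Ico]
  constructor <;> rintro ⟨h1, h2⟩ <;> constructor <;> linarith

lemma sub_halfStep_zero [NeZero n] (s : Fin n → ℝ) (N : ℕ) (x : EuclideanSpace ℝ (Fin n)) :
    (x - halfStep s N) 0 = x 0 - s 0 / N / 2 := by
  simp [halfStep]

lemma sub_halfStep_of_ne [NeZero n] (s : Fin n → ℝ) (N : ℕ) (x : EuclideanSpace ℝ (Fin n))
    {i : Fin n} (hi : i ≠ 0) : (x - halfStep s N) i = x i := by
  simp [halfStep, hi]

lemma sub_halfStep_mem_boxCylinder [NeZero n] {c s : Fin n → ℝ} {N : ℕ}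
    {x : EuclideanSpace ℝ (Fin n)} :
    x - halfStep s N ∈ boxCylinder c s ↔ x ∈ boxCylinder c s := by
  refine forall_congr' fun i => forall_congr' fun hi => ?_
  rw [sub_halfStep_of_ne s N x hi]

lemma boxOsc_eq_sub [NeZero n] (c s : Fin n → ℝ) (N : ℕ) (x : EuclideanSpace ℝ (Fin n)) :
    boxOsc c s N x = boxOscPos c s N x - boxOscPos c s N (x - halfStep s N) := by
  have h1 : (boxCylinder c s).indicator (1 : EuclideanSpace ℝ (Fin n) → ℝ) (x - halfStep s N) =
      (boxCylinder c s).indicator 1 x := by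
    classical simp only [Set.indicator_apply, sub_halfStep_mem_boxCylinder, Pi.one_apply]
  rw [boxOsc, boxOscPos, boxOscPos, h1, ← sub_mul, ← Finset.sum_sub_distrib]
  congr 1
  refine Finset.sum_congr rfl fun i _ => ?_
  rw [haarSign, sub_halfStep_zero]
  congr 1
  simp only [Set.indicator, mem_Ico_sub_iff, Pi.one_apply]
  rw [add_assoc (c 0 + i * (s 0 / N)), add_halves]

lemma sum_indicator_Ico (a h : ℝ) (hh : 0 ≤ h) (N : ℕ) (t : ℝ) :
    ∑ i ∈ Finset.range N, (Set.Ico (a + i * h) (a + (i + 1) * h)).indicator (1 : ℝ → ℝ) t =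
      (Set.Ico a (a + N * h)).indicator 1 t := by
  induction N with
  | zero => simp
  | succ N ih =>
    rw [Finset.sum_range_succ, ih]
    have h0 : 0 ≤ N * h := by positivity
    have h1 : a ≤ a + N * h := by linarith
    have h2 : a + N * h ≤ a + (N + 1) * h := by linarith
    push_cast
    rw [← Set.Ico_union_Ico_eq_Ico h1 h2, Set.indicator_union_of_disjoint]
    rw [Set.disjoint_left]
    intro x hx hx'
    exact absurd hx.2 (not_lt.2 hx'.1)

lemma boxOscPos_nonneg [NeZero n] (c s : Fin n → ℝ) (N : ℕ) (x : EuclideanSpace ℝ (Fin n)) :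
    0 ≤ boxOscPos c s N x :=
  mul_nonneg (Finset.sum_nonneg fun _ _ => Set.indicator_nonneg (fun _ _ => zero_le_one) _)
    (Set.indicator_nonneg (fun _ _ => zero_le_one) _)

lemma boxOscPos_le_indicator [NeZero n] {c s : Fin n → ℝ} (hs : 0 < s 0) (N : ℕ)
    (x : EuclideanSpace ℝ (Fin n)) :
    boxOscPos c s N x ≤ (halfOpenBox c s).indicator 1 x := by
  rcases Nat.eq_zero_or_pos N with rfl | hN
  · rw [boxOscPos, Finset.range_zero, Finset.sum_empty, zero_mul]
    exact Set.indicator_nonneg (fun _ _ => zero_le_one) x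
  have hh : 0 < s 0 / N := by positivity
  have h1 : ∑ i ∈ Finset.range N, (Set.Ico (c 0 + i * (s 0 / N))
      (c 0 + i * (s 0 / N) + s 0 / N / 2)).indicator (1 : ℝ → ℝ) (x 0) ≤
      (Set.Ico (c 0) (c 0 + s 0)).indicator 1 (x 0) := by
    have := sum_indicator_Ico (c 0) (s 0 / N) hh.le N (x 0)
    rw [mul_div_cancel₀ _ (by positivity : (N : ℝ) ≠ 0)] at this
    rw [← this]
    refine Finset.sum_le_sum fun i _ => ?_
    refine Set.indicator_le_indicator_of_subset (Set.Ico_subset_Ico_right ?_)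
      (fun _ => zero_le_one) _
    linarith
  refine (mul_le_mul_of_nonneg_right h1 (Set.indicator_nonneg (fun _ _ => zero_le_one) _)).trans
    (le_of_eq ?_)
  by_cases hx : x ∈ halfOpenBox c s
  · have h2 : x ∈ boxCylinder c s := fun i _ => hx i
    rw [Set.indicator_of_mem hx, Set.indicator_of_mem h2, Set.indicator_of_mem (hx 0)]
    simp
  · rw [Set.indicator_of_notMem hx]
    by_cases h2 : x ∈ boxCylinder c s
    · rw [Set.indicator_of_notMem (s := Set.Ico (c 0) (c 0 + s 0)), zero_mul]
      intro h0
      refine hx fun i => ?_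
      rcases eq_or_ne i 0 with rfl | hi
      · exact h0
      · exact h2 i hi
    · rw [Set.indicator_of_notMem h2, mul_zero]

lemma abs_boxOscPos_le_one [NeZero n] {c s : Fin n → ℝ} (hs : 0 < s 0) (N : ℕ)
    (x : EuclideanSpace ℝ (Fin n)) : |boxOscPos c s N x| ≤ 1 := by
  rw [abs_of_nonneg (boxOscPos_nonneg c s N x)]
  exact (boxOscPos_le_indicator hs N x).trans
    (Set.indicator_apply_le' (fun _ => le_rfl) fun _ => zero_le_one)

lemma boxOscPos_eq_zero [NeZero n] {c s : Fin n → ℝ} (hs : 0 < s 0) (N : ℕ)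
    {x : EuclideanSpace ℝ (Fin n)} (hx : x ∉ halfOpenBox c s) : boxOscPos c s N x = 0 := by
  have := boxOscPos_le_indicator hs N x (c := c)
  rw [Set.indicator_of_notMem hx] at this
  exact le_antisymm this (boxOscPos_nonneg c s N x)

lemma boxOscPos_sub_eq_zero [NeZero n] {c s : Fin n → ℝ} (hs : 0 < s 0) (N : ℕ)
    {x : EuclideanSpace ℝ (Fin n)} (hx : x ∉ halfOpenBox c s) :
    boxOscPos c s N (x - halfStep s N) = 0 := by
  by_cases h2 : x ∈ boxCylinder c s
  · have h0 : x 0 ∉ Set.Ico (c 0) (c 0 + s 0) := fun h0 => hx fun i => by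
      rcases eq_or_ne i 0 with rfl | hi
      · exact h0
      · exact h2 i hi
    rw [boxOscPos, sub_halfStep_zero, Finset.sum_eq_zero, zero_mul]
    intro i hi
    refine Set.indicator_of_notMem (fun h => h0 ?_) _
    have hiN : ((i : ℝ) + 1) ≤ N := by exact_mod_cast Finset.mem_range.1 hi
    have hN : (0 : ℝ) < N := lt_of_lt_of_le (by positivity) hiN
    have hh : 0 < s 0 / N := by positivity
    have e : N * (s 0 / N) = s 0 := mul_div_cancel₀ _ hN.ne'
    have e2 : (i + 1) * (s 0 / N) ≤ N * (s 0 / N) := by gcongr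
    have e3 : 0 ≤ i * (s 0 / N) := by positivity
    constructor <;> linarith [h.1, h.2]
  · rw [boxOscPos, Set.indicator_of_notMem (by rwa [sub_halfStep_mem_boxCylinder]), mul_zero]

lemma boxOsc_eq_zero [NeZero n] {c s : Fin n → ℝ} (hs : 0 < s 0) (N : ℕ)
    {x : EuclideanSpace ℝ (Fin n)} (hx : x ∉ halfOpenBox c s) : boxOsc c s N x = 0 := by
  rw [boxOsc_eq_sub, boxOscPos_eq_zero hs N hx, boxOscPos_sub_eq_zero hs N hx, sub_zero]

lemma abs_boxOsc_le_one [NeZero n] {c s : Fin n → ℝ} (hs : 0 < s 0) (N : ℕ)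
    (x : EuclideanSpace ℝ (Fin n)) : |boxOsc c s N x| ≤ 1 := by
  have h1 := abs_boxOscPos_le_one hs N x (c := c)
  have h2 := abs_boxOscPos_le_one hs N (x - halfStep s N) (c := c)
  rw [boxOsc_eq_sub, abs_le]
  have := boxOscPos_nonneg c s N x
  have := boxOscPos_nonneg c s N (x - halfStep s N)
  rw [abs_le] at h1 h2
  constructor <;> linarith

lemma measurableSet_halfOpenBox (c s : Fin n → ℝ) : MeasurableSet (halfOpenBox c s) := by
  have : halfOpenBox c s = ⋂ i, (fun x : EuclideanSpace ℝ (Fin n) => x i) ⁻¹'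
      Set.Ico (c i) (c i + s i) := by
    ext x; simp [halfOpenBox]
  rw [this]
  exact MeasurableSet.iInter fun i => measurableSet_Ico.preimage (by fun_prop)

lemma measurableSet_boxCylinder [NeZero n] (c s : Fin n → ℝ) :
    MeasurableSet (boxCylinder c s) := by
  have : boxCylinder c s = ⋂ i, ⋂ (_ : i ≠ 0), (fun x : EuclideanSpace ℝ (Fin n) => x i) ⁻¹'
      Set.Ico (c i) (c i + s i) := by
    ext x; simp [boxCylinder]
  rw [this]
  exact MeasurableSet.iInter fun i => MeasurableSet.iInter fun _ =>
    measurableSet_Ico.preimage (by fun_prop)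

lemma measurable_boxOscPos [NeZero n] (c s : Fin n → ℝ) (N : ℕ) :
    Measurable (boxOscPos c s N) := by
  unfold boxOscPos
  refine Measurable.mul (Finset.measurable_fun_sum _ fun i _ => ?_)
    (measurable_one.indicator (measurableSet_boxCylinder c s))
  exact (measurable_one.indicator measurableSet_Ico).comp (by fun_prop)

lemma measurable_boxOsc [NeZero n] (c s : Fin n → ℝ) (N : ℕ) :
    Measurable (boxOsc c s N) := by
  have : boxOsc c s N = fun x => boxOscPos c s N x - boxOscPos c s N (x - halfStep s N) :=
    funext (boxOsc_eq_sub c s N)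
  rw [this]
  exact (measurable_boxOscPos c s N).sub
    ((measurable_boxOscPos c s N).comp (measurable_id.sub_const _))

lemma ae_coord_ne (i : Fin n) (t : ℝ) : ∀ᵐ x : EuclideanSpace ℝ (Fin n), x i ≠ t :=
  (PiLp.volume_preserving_ofLp (Fin n)).quasiMeasurePreserving.ae
    (Measure.ae_eval_ne (fun _ => volume) i t)

/-- Integrals over a box of functions of one coordinate are one-dimensional. -/
lemma lintegral_halfOpenBox (c s : Fin n → ℝ) (i : Fin n) {φ : ℝ → ENNReal} (hφ : Measurable φ) :
    ∫⁻ x in halfOpenBox c s, φ (x i) =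
      (∏ j ∈ Finset.univ.erase i, ENNReal.ofReal (s j)) *
        ∫⁻ t in Set.Ico (c i) (c i + s i), φ t := by
  have hset : halfOpenBox c s = (WithLp.ofLp : EuclideanSpace ℝ (Fin n) → Fin n → ℝ) ⁻¹'
      (Set.univ.pi fun j => Set.Ico (c j) (c j + s j)) := by
    ext x; simp [halfOpenBox, Set.mem_pi]
  rw [hset, (PiLp.volume_preserving_ofLp (Fin n)).setLIntegral_comp_preimage
    (MeasurableSet.univ_pi fun j => measurableSet_Ico) (f := fun y => φ (y i))
    (hφ.comp (measurable_pi_apply i)), volume_pi, Measure.restrict_pi_pi,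
    ← lintegral_map (f := φ) hφ (measurable_pi_apply i)]
  have := Measure.pi_map_eval (μ := fun j => (volume : Measure ℝ).restrict
    (Set.Ico (c j) (c j + s j))) i
  rw [show (fun b : Fin n → ℝ => b i) = Function.eval i from rfl, this, lintegral_smul_measure]
  simp

lemma volume_halfOpenBox_lt_top (c s : Fin n → ℝ) : volume (halfOpenBox c s) < ⊤ := by
  have hset : halfOpenBox c s = (WithLp.ofLp : EuclideanSpace ℝ (Fin n) → Fin n → ℝ) ⁻¹'
      (Set.univ.pi fun j => Set.Ico (c j) (c j + s j)) := by
    ext x; simp [halfOpenBox, Set.mem_pi]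
  rw [hset, (PiLp.volume_preserving_ofLp (Fin n)).measure_preimage
    (MeasurableSet.univ_pi fun j => measurableSet_Ico).nullMeasurableSet, Real.volume_pi_Ico]
  exact ENNReal.prod_lt_top fun i _ => by simp

lemma integrable_boxOscPos [NeZero n] {c s : Fin n → ℝ} (hs : 0 < s 0) (N : ℕ) :
    Integrable (boxOscPos c s N) := by
  refine Integrable.mono' ((integrable_indicator_iff (measurableSet_halfOpenBox c s)).2
    (integrableOn_const (C := (1 : ℝ)) (volume_halfOpenBox_lt_top c s).ne))
    (measurable_boxOscPos c s N).aestronglyMeasurable (.of_forall fun x => ?_)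
  rw [Real.norm_of_nonneg (boxOscPos_nonneg c s N x)]
  exact boxOscPos_le_indicator hs N x

lemma integrable_boxOsc [NeZero n] {c s : Fin n → ℝ} (hs : 0 < s 0) (N : ℕ) :
    Integrable (boxOsc c s N) := by
  have : boxOsc c s N = fun x => boxOscPos c s N x - boxOscPos c s N (x - halfStep s N) :=
    funext (boxOsc_eq_sub c s N)
  rw [this]
  exact (integrable_boxOscPos hs N).sub ((integrable_boxOscPos hs N).comp_sub_right _)

/-- The coordinate hyperplanes across which `boxOsc` may jump do not pass through `x`. -/
def OffWalls [NeZero n] (c s : Fin n → ℝ) (N : ℕ) (x : EuclideanSpace ℝ (Fin n)) : Prop :=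
  (∀ m ∈ Finset.range (2 * N + 1), x 0 ≠ c 0 + m * (s 0 / N / 2)) ∧
    ∀ i, x i ≠ c i ∧ x i ≠ c i + s i

lemma ae_offWalls [NeZero n] (c s : Fin n → ℝ) (N : ℕ) : ∀ᵐ x, OffWalls c s N x := by
  refine Filter.Eventually.and ?_ ?_
  · exact (Finset.eventually_all _).2 fun m _ => ae_coord_ne 0 _
  · exact ae_all_iff.2 fun i => (ae_coord_ne i _).and (ae_coord_ne i _)

lemma mem_Ico_iff_of_abs_sub_lt {u v t t' r : ℝ} (hu : r ≤ |t - u|) (hv : r ≤ |t - v|)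
    (h : |t' - t| < r) : t' ∈ Set.Ico u v ↔ t ∈ Set.Ico u v := by
  have key : ∀ w, r ≤ |t - w| → (w ≤ t' ↔ w ≤ t) := by
    intro w hw
    rw [abs_lt] at h
    rcases le_abs'.1 hw with h1 | h1
    · constructor <;> intro _ <;> linarith
    · constructor <;> intro _ <;> linarith
  rw [Set.mem_Ico, Set.mem_Ico, key u hu, ← not_le, ← not_le, key v hv]

/-- At a point off the walls, `boxOsc` is constant on a ball whose radius is the scale of the
oscillation or the distance to one of the walls. -/
lemma OffWalls.exists_radius [NeZero n] {c s : Fin n → ℝ} (hs : 0 < s 0) {N : ℕ} (hN : 0 < N)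
    {x : EuclideanSpace ℝ (Fin n)} (hx : OffWalls c s N x) :
    ∃ r : ℝ, 0 < r ∧ r ≤ s 0 / N / 2 ∧
      (∀ y, ‖y‖ < r → boxOsc c s N (x - y) = boxOsc c s N x) ∧
      (r = s 0 / N / 2 ∨ (∃ m ∈ Finset.range (2 * N + 1), r = |x 0 - (c 0 + m * (s 0 / N / 2))|) ∨
        ∃ i, r = |x i - c i| ∨ r = |x i - (c i + s i)|) := by
  set δ := s 0 / N / 2 with hδ
  have hδ0 : 0 < δ := by positivity
  set S : Finset ℝ := insert δ ((Finset.range (2 * N + 1)).image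
    (fun m : ℕ => |x 0 - (c 0 + m * δ)|) ∪ (Finset.univ.image (fun i => |x i - c i|) ∪
      Finset.univ.image fun i => |x i - (c i + s i)|)) with hS
  have hSne : S.Nonempty := ⟨δ, Finset.mem_insert_self _ _⟩
  have hmem := S.min'_mem hSne
  have hle : ∀ d ∈ S, S.min' hSne ≤ d := fun d hd => S.min'_le d hd
  set r := S.min' hSne with hr
  have h1 : ∀ m ∈ Finset.range (2 * N + 1), r ≤ |x 0 - (c 0 + m * δ)| := fun m hm =>
    hle _ (Finset.mem_insert_of_mem (Finset.mem_union_left _ (Finset.mem_image_of_mem _ hm)))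
  have h2 : ∀ i, r ≤ |x i - c i| := fun i => hle _ (Finset.mem_insert_of_mem
    (Finset.mem_union_right _ (Finset.mem_union_left _
      (Finset.mem_image_of_mem _ (Finset.mem_univ i)))))
  have h3 : ∀ i, r ≤ |x i - (c i + s i)| := fun i => hle _ (Finset.mem_insert_of_mem
    (Finset.mem_union_right _ (Finset.mem_union_right _
      (Finset.mem_image_of_mem (fun i => |x i - (c i + s i)|) (Finset.mem_univ i)))))
  have hcases : r = δ ∨ (∃ m ∈ Finset.range (2 * N + 1), r = |x 0 - (c 0 + m * δ)|) ∨
      ∃ i, r = |x i - c i| ∨ r = |x i - (c i + s i)| := by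
    rw [hS, Finset.mem_insert, Finset.mem_union, Finset.mem_union, Finset.mem_image,
      Finset.mem_image, Finset.mem_image] at hmem
    rcases hmem with h | ⟨m, hm, h⟩ | ⟨i, -, h⟩ | ⟨i, -, h⟩
    · exact Or.inl h
    · exact Or.inr (Or.inl ⟨m, hm, h.symm⟩)
    · exact Or.inr (Or.inr ⟨i, Or.inl h.symm⟩)
    · exact Or.inr (Or.inr ⟨i, Or.inr h.symm⟩)
  refine ⟨r, ?_, hle δ (Finset.mem_insert_self _ _), ?_, hcases⟩
  · rcases hcases with h | ⟨m, hm, h⟩ | ⟨i, h | h⟩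
    · rw [h]; exact hδ0
    · rw [h]; exact abs_pos.2 (sub_ne_zero.2 (hx.1 m hm))
    · rw [h]; exact abs_pos.2 (sub_ne_zero.2 (hx.2 i).1)
    · rw [h]; exact abs_pos.2 (sub_ne_zero.2 (hx.2 i).2)
  · intro y hy
    have hy' : ∀ i, |(x - y) i - x i| < r := fun i => by
      have : (x - y) i - x i = -(y i) := by simp
      rw [this, abs_neg]
      exact (abs_coord_le_norm y i).trans_lt hy
    have hcyl : x - y ∈ boxCylinder c s ↔ x ∈ boxCylinder c s :=
      forall_congr' fun i => forall_congr' fun _ =>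
        mem_Ico_iff_of_abs_sub_lt (h2 i) (h3 i) (hy' i)
    have e1 : (boxCylinder c s).indicator (1 : EuclideanSpace ℝ (Fin n) → ℝ) (x - y) =
        (boxCylinder c s).indicator 1 x := by
      classical simp only [Set.indicator_apply, hcyl, Pi.one_apply]
    rw [boxOsc, boxOsc, e1]
    congr 1
    refine Finset.sum_congr rfl fun i hi => ?_
    have hi' := Finset.mem_range.1 hi
    have w0 := h1 (2 * i) (by rw [Finset.mem_range]; omega)
    have w1 := h1 (2 * i + 1) (by rw [Finset.mem_range]; omega)
    have w2 := h1 (2 * i + 2) (by rw [Finset.mem_range]; omega)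
    have e0 : c 0 + ((2 * i : ℕ) : ℝ) * δ = c 0 + i * (s 0 / N) := by rw [hδ]; push_cast; ring
    have e1 : c 0 + ((2 * i + 1 : ℕ) : ℝ) * δ = c 0 + i * (s 0 / N) + s 0 / N / 2 := by
      rw [hδ]; push_cast; ring
    have e2 : c 0 + ((2 * i + 2 : ℕ) : ℝ) * δ = c 0 + i * (s 0 / N) + s 0 / N := by
      rw [hδ]; push_cast; ring
    rw [e0] at w0
    rw [e1] at w1
    rw [e2] at w2
    simp only [haarSign, Set.indicator, mem_Ico_iff_of_abs_sub_lt w0 w1 (hy' 0),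
      mem_Ico_iff_of_abs_sub_lt w1 w2 (hy' 0), Pi.one_apply]

/-- The principal value of `boxOsc` exists off the walls. -/
lemma ae_rieszPVExists_boxOsc [NeZero n] {c s : Fin n → ℝ} (hs : 0 < s 0) {N : ℕ} (hN : 0 < N)
    (j : Fin n) : ∀ᵐ x, RieszPVExists j (boxOsc c s N) x := by
  filter_upwards [ae_offWalls c s N] with x hx
  obtain ⟨r, hr, -, hxr, -⟩ := hx.exists_radius hs hN
  exact (rieszTransform_of_const_near j (integrable_boxOsc hs N) hr hxr).1

/-! ### Integral bounds -/

lemma integrable_indicator_inv_rpow {α : ℝ} (hα1 : α < 1) :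
    Integrable ((Set.Ioo (-1 : ℝ) 1).indicator fun u => (1 / |u|) ^ α) := by
  rw [integrable_indicator_iff measurableSet_Ioo]
  have h := (integrableOn_fun_norm_addHaar (E := ℝ) (μ := volume) (r := 1)
    (f := fun t : ℝ => (1 / t) ^ α)).2 ?_
  · rwa [Real.ball_eq_Ioo, zero_sub, zero_add] at h
  · have h1 : IntegrableOn (fun t : ℝ => t ^ (-α)) (Set.Ioo 0 1) :=
      (intervalIntegral.integrableOn_Ioo_rpow_iff one_pos).2 (by linarith)
    refine h1.congr_fun (fun t ht => ?_) measurableSet_Ioo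
    simp [Real.inv_rpow ht.1.le, Real.rpow_neg ht.1.le]

/-- The integral of a weak singularity over an interval scales like the length. -/
lemma exists_lintegral_singularity {α : ℝ} (hα1 : α < 1) :
    ∃ κ : ENNReal, κ ≠ ⊤ ∧ ∀ δ w : ℝ, 0 < δ →
      ∫⁻ t in Set.Ioo (w - δ) (w + δ), ENNReal.ofReal ((δ / |t - w|) ^ α) =
        ENNReal.ofReal δ * κ := by
  set F : ℝ → ℝ := (Set.Ioo (-1 : ℝ) 1).indicator fun u => (1 / |u|) ^ α with hF
  have hFi : Integrable F := integrable_indicator_inv_rpow hα1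
  have hF0 : ∀ u, 0 ≤ F u := fun u => Set.indicator_nonneg (fun u _ => by positivity) u
  refine ⟨ENNReal.ofReal (∫ u, F u), ENNReal.ofReal_ne_top, fun δ w hδ => ?_⟩
  have h1 : ∀ t, (Set.Ioo (w - δ) (w + δ)).indicator
      (fun t => ENNReal.ofReal ((δ / |t - w|) ^ α)) t = ENNReal.ofReal (F ((t - w) / δ)) := by
    intro t
    have hiff : t ∈ Set.Ioo (w - δ) (w + δ) ↔ (t - w) / δ ∈ Set.Ioo (-1 : ℝ) 1 := by
      rw [Set.mem_Ioo, Set.mem_Ioo, lt_div_iff₀ hδ, div_lt_iff₀ hδ]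
      constructor <;> rintro ⟨h1, h2⟩ <;> constructor <;> linarith
    by_cases ht : t ∈ Set.Ioo (w - δ) (w + δ)
    · rw [hF, Set.indicator_of_mem ht, Set.indicator_of_mem (hiff.1 ht), abs_div, abs_of_pos hδ,
        one_div_div]
    · rw [hF, Set.indicator_of_notMem ht, Set.indicator_of_notMem fun h => ht (hiff.2 h),
        ENNReal.ofReal_zero]
  rw [← lintegral_indicator measurableSet_Ioo]
  simp_rw [h1]
  rw [lintegral_sub_right_eq_self (fun t => ENNReal.ofReal (F (t / δ))) w,
    ← ofReal_integral_eq_lintegral_ofReal (hFi.comp_div hδ.ne') (.of_forall fun t => hF0 _),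
    Measure.integral_comp_div, abs_of_pos hδ, smul_eq_mul, ENNReal.ofReal_mul hδ.le]

lemma lintegral_singularity_Ico_ne_top {α : ℝ} (hα1 : α < 1) {L : ℝ} (hL : 0 < L) (w u v : ℝ) :
    ∫⁻ t in Set.Ico u v, ENNReal.ofReal ((L / |t - w|) ^ α) ≠ ⊤ := by
  obtain ⟨κ, hκ, h⟩ := exists_lintegral_singularity hα1
  set δ := |u - w| + |v - w| + 1 with hδ
  have hδ0 : 0 < δ := by positivity
  have hsub : Set.Ico u v ⊆ Set.Ioo (w - δ) (w + δ) := by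
    intro t ht
    have h1 := neg_abs_le (u - w)
    have h2 := le_abs_self (v - w)
    have h3 := abs_nonneg (u - w)
    have h4 := abs_nonneg (v - w)
    constructor <;> linarith [ht.1, ht.2]
  have e : ∀ t, ENNReal.ofReal ((L / |t - w|) ^ α) =
      ENNReal.ofReal ((L / δ) ^ α) * ENNReal.ofReal ((δ / |t - w|) ^ α) := by
    intro t
    rw [← ENNReal.ofReal_mul (by positivity), ← Real.mul_rpow (by positivity) (by positivity)]
    congr 2
    field_simp
  refine ne_top_of_le_ne_top ?_ (lintegral_mono_set hsub)
  simp_rw [e]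
  rw [lintegral_const_mul' _ _ ENNReal.ofReal_ne_top, h δ w hδ0]
  exact ENNReal.mul_ne_top ENNReal.ofReal_ne_top (ENNReal.mul_ne_top ENNReal.ofReal_ne_top hκ)

lemma measurable_singularity (α L w : ℝ) :
    Measurable fun t : ℝ => ENNReal.ofReal ((L / |t - w|) ^ α) := by
  fun_prop

lemma lintegral_box_singularity_ne_top {α : ℝ} (hα1 : α < 1) {L : ℝ} (hL : 0 < L) (w : ℝ)
    (c s : Fin n → ℝ) (i : Fin n) :
    ∫⁻ x in halfOpenBox c s, ENNReal.ofReal ((L / |x i - w|) ^ α) ≠ ⊤ := by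
  rw [lintegral_halfOpenBox c s i (measurable_singularity α L w)]
  exact ENNReal.mul_ne_top (ENNReal.prod_ne_top fun _ _ => ENNReal.ofReal_ne_top)
    (lintegral_singularity_Ico_ne_top hα1 hL w _ _)

lemma enorm_rpow_eq_ofReal (a : ℝ) {q : ℝ} (hq : 0 ≤ q) :
    ‖a‖ₑ ^ q = ENNReal.ofReal (|a| ^ q) := by
  rw [← ENNReal.ofReal_rpow_of_nonneg (abs_nonneg a) hq, Real.enorm_eq_ofReal_abs]

/-- On the box, the `q`-th powers of the Riesz transforms of the oscillations have uniformly bounded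
integrals: each of the `2 * N + 1` walls carries a singularity of integral comparable to the scale
`s 0 / N / 2` of the oscillation. -/
lemma exists_lintegral_rieszTransform_box_le [NeZero n] {c s : Fin n → ℝ} (hs : 0 < s 0)
    {q : ℝ} (hq : 0 < q) (j : Fin n) :
    ∃ C : ENNReal, C ≠ ⊤ ∧ ∀ N : ℕ, 0 < N →
      ∫⁻ x in halfOpenBox c s, ‖rieszTransform j (boxOsc c s N) x‖ₑ ^ q ≤ C := by
  -- With `θ = 1 / (4 * q)` the `q`-th power of the pointwise bound has the exponent `1 / 4`.
  have hθ : 0 < 1 / (4 * q) := by positivity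
  obtain ⟨C₀, hC₀, hbound⟩ := exists_abs_rieszTransform_le_of_const_near (n := n) hθ
  obtain ⟨κ, hκ, hκe⟩ := exists_lintegral_singularity (α := 1 / 4) (by norm_num)
  set P := ∏ j ∈ Finset.univ.erase (0 : Fin n), ENNReal.ofReal (s j) with hP
  set B : ℝ → ℝ → ENNReal := fun w t => ENNReal.ofReal ((s 0 / |t - w|) ^ (1 / 4 : ℝ)) with hB
  have hBm : ∀ w, Measurable (B w) := fun w => measurable_singularity _ _ _
  refine ⟨ENNReal.ofReal (C₀ ^ q) * (volume (halfOpenBox c s) +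
    P * (ENNReal.ofReal (2 * s 0) * κ) + ∑ i, ((∫⁻ x in halfOpenBox c s, B (c i) (x i)) +
      ∫⁻ x in halfOpenBox c s, B (c i + s i) (x i))), ?_, fun N hN => ?_⟩
  · have h1 : P ≠ ⊤ := ENNReal.prod_ne_top fun _ _ => ENNReal.ofReal_ne_top
    refine ENNReal.mul_ne_top ENNReal.ofReal_ne_top (ENNReal.add_ne_top.2 ⟨ENNReal.add_ne_top.2
      ⟨(volume_halfOpenBox_lt_top c s).ne, ENNReal.mul_ne_top h1
        (ENNReal.mul_ne_top ENNReal.ofReal_ne_top hκ)⟩, ENNReal.sum_ne_top.2 fun i _ =>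
          ENNReal.add_ne_top.2 ⟨?_, ?_⟩⟩)
    · exact lintegral_box_singularity_ne_top (by norm_num) hs _ _ _ _
    · exact lintegral_box_singularity_ne_top (by norm_num) hs _ _ _ _
  set δ := s 0 / N / 2 with hδ
  have hδ0 : 0 < δ := by positivity
  have hδs : δ ≤ s 0 := by
    have : s 0 / N ≤ s 0 := div_le_self hs.le (by exact_mod_cast hN)
    linarith
  have hv := norm_halfStep hs.le N
  set w : ℕ → ℝ := fun m => c 0 + m * δ with hw
  -- A wall orthogonal to the first coordinate matters only up to the distance `δ`; without this
  -- cutoff the sum over the walls would not be bounded uniformly in `N`.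
  set A : ℕ → ℝ → ENNReal := fun m => (Set.Ioo (w m - δ) (w m + δ)).indicator
    fun t => ENNReal.ofReal ((δ / |t - w m|) ^ (1 / 4 : ℝ)) with hA
  have hAm : ∀ m, Measurable (A m) := fun m =>
    (measurable_singularity _ _ _).indicator measurableSet_Ioo
  set T : EuclideanSpace ℝ (Fin n) → ENNReal := fun x =>
    1 + ∑ m ∈ Finset.range (2 * N + 1), A m (x 0) + ∑ i, (B (c i) (x i) + B (c i + s i) (x i))
    with hT
  have hpt : ∀ᵐ x, ‖rieszTransform j (boxOsc c s N) x‖ₑ ^ q ≤ ENNReal.ofReal (C₀ ^ q) * T x := by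
    filter_upwards [ae_offWalls c s N] with x hx
    obtain ⟨r, hr, hrδ, hxr, hcases⟩ := hx.exists_radius hs hN
    have h1 := hbound j (boxOsc c s N) (boxOscPos c s N) (halfStep s N) x r
      (integrable_boxOscPos hs N) (abs_boxOscPos_le_one hs N) (boxOsc_eq_sub c s N) hr
      (hrδ.trans_eq hv.symm) hxr
    rw [hv, ← hδ] at h1
    have h2 : |rieszTransform j (boxOsc c s N) x| ^ q ≤ C₀ ^ q * (δ / r) ^ (1 / 4 : ℝ) := by
      refine (Real.rpow_le_rpow (abs_nonneg _) h1 hq.le).trans_eq ?_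
      rw [Real.mul_rpow hC₀ (by positivity), ← Real.rpow_mul (by positivity)]
      congr 2
      field_simp
    rw [enorm_rpow_eq_ofReal _ hq.le]
    refine (ENNReal.ofReal_le_ofReal h2).trans ?_
    rw [ENNReal.ofReal_mul (by positivity)]
    gcongr _ * ?_
    rcases eq_or_ne r δ with h | hne
    · rw [h, div_self hδ0.ne', Real.one_rpow, ENNReal.ofReal_one, hT]
      simp only [add_assoc]
      exact le_self_add
    have hlt : r < δ := lt_of_le_of_ne hrδ hne
    have hBle : ∀ i, B (c i) (x i) + B (c i + s i) (x i) ≤ T x := fun i =>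
      (Finset.single_le_sum (f := fun i => B (c i) (x i) + B (c i + s i) (x i))
        (fun _ _ => zero_le) (Finset.mem_univ i)).trans le_add_self
    rcases hcases with h | ⟨m, hm, h⟩ | ⟨i, h | h⟩
    · exact absurd h hne
    · refine le_trans ?_ (le_self_add (b := ∑ i, (B (c i) (x i) + B (c i + s i) (x i))))
      refine le_trans ?_ (le_add_self (b := (1 : ENNReal)))
      refine le_trans (le_of_eq ?_) (Finset.single_le_sum (f := fun m => A m (x 0))
        (fun _ _ => zero_le) hm)
      have hmem : x 0 ∈ Set.Ioo (w m - δ) (w m + δ) := by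
        replace h : r = |x 0 - w m| := h
        rw [h, abs_lt] at hlt
        constructor <;> linarith [hlt.1, hlt.2]
      simp only [hA]
      rw [Set.indicator_of_mem hmem, show |x 0 - w m| = r from h.symm]
    · refine le_trans ?_ ((le_self_add (a := B (c i) (x i))).trans (hBle i))
      simp only [hB]
      rw [← h]
      exact ENNReal.ofReal_le_ofReal (by gcongr)
    · refine le_trans ?_ ((le_add_self (a := B (c i + s i) (x i))).trans (hBle i))
      simp only [hB]
      rw [← h]
      exact ENNReal.ofReal_le_ofReal (by gcongr)
  refine (lintegral_mono_ae (ae_restrict_of_ae hpt)).trans ?_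
  rw [lintegral_const_mul' _ _ ENNReal.ofReal_ne_top]
  gcongr _ * ?_
  have hm1 : Measurable fun x : EuclideanSpace ℝ (Fin n) =>
      ∑ m ∈ Finset.range (2 * N + 1), A m (x 0) :=
    Finset.measurable_fun_sum _ fun m _ => (hAm m).comp (by fun_prop)
  have hm2 : ∀ w i, Measurable fun x : EuclideanSpace ℝ (Fin n) => B w (x i) :=
    fun w i => (hBm w).comp (by fun_prop)
  simp only [hT]
  rw [lintegral_add_left (by exact measurable_const.add hm1),
    lintegral_add_left measurable_const,
    lintegral_finsetSum _ (fun m _ => by exact (hAm m).comp (by fun_prop)),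
    lintegral_finsetSum _ (fun i _ => by exact (hm2 _ i).add (hm2 _ i))]
  gcongr ?_ + ?_ + ?_
  · simp
  · have h1 : ∀ m, ∫⁻ x in halfOpenBox c s, A m (x 0) ≤ P * (ENNReal.ofReal δ * κ) := by
      intro m
      rw [lintegral_halfOpenBox c s 0 (hAm m)]
      gcongr _ * ?_
      refine (setLIntegral_le_lintegral _ _).trans_eq ?_
      rw [hA, lintegral_indicator measurableSet_Ioo, hκe δ _ hδ0]
    refine (Finset.sum_le_sum fun m _ => h1 m).trans ?_
    rw [Finset.sum_const, Finset.card_range, nsmul_eq_mul]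
    have h2 : ((2 * N + 1 : ℕ) : ENNReal) * ENNReal.ofReal δ ≤ ENNReal.ofReal (2 * s 0) := by
      rw [← ENNReal.ofReal_natCast, ← ENNReal.ofReal_mul (by positivity)]
      refine ENNReal.ofReal_le_ofReal ?_
      have h3 : (N : ℝ) * δ = s 0 / 2 := by rw [hδ]; field_simp
      push_cast
      linarith
    calc ((2 * N + 1 : ℕ) : ENNReal) * (P * (ENNReal.ofReal δ * κ))
        = P * ((((2 * N + 1 : ℕ) : ENNReal) * ENNReal.ofReal δ) * κ) := by ring
      _ ≤ _ := by gcongr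
  · refine le_of_eq (Finset.sum_congr rfl fun i _ => ?_)
    rw [lintegral_add_left (hm2 _ i)]

lemma isBounded_halfOpenBox (c s : Fin n → ℝ) : Bornology.IsBounded (halfOpenBox c s) := by
  refine ((PiLp.antilipschitzWith_ofLp 2 (fun _ : Fin n => ℝ)).isBounded_preimage
    (Metric.isBounded_Icc c (c + s))).subset fun x hx => ?_
  exact ⟨fun i => (hx i).1, fun i => (hx i).2.le⟩

lemma exists_radius_of_notMem_box {c s : Fin n → ℝ} {x : EuclideanSpace ℝ (Fin n)}
    (hx : x ∉ halfOpenBox c s) (hw : ∀ i, x i ≠ c i ∧ x i ≠ c i + s i) :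
    ∃ i r, 0 < r ∧ (r = |x i - c i| ∨ r = |x i - (c i + s i)|) ∧
      ∀ y, ‖y‖ < r → x - y ∉ halfOpenBox c s := by
  simp only [halfOpenBox, Set.mem_ofPred_eq, not_forall] at hx
  obtain ⟨i, hi⟩ := hx
  refine ⟨i, min |x i - c i| |x i - (c i + s i)|, lt_min (abs_pos.2 (sub_ne_zero.2 (hw i).1))
    (abs_pos.2 (sub_ne_zero.2 (hw i).2)), min_choice _ _, fun y hy hmem => hi ?_⟩
  refine (mem_Ico_iff_of_abs_sub_lt (min_le_left _ _) (min_le_right _ _) ?_).1 (hmem i)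
  have : (x - y) i - x i = -(y i) := by simp
  rw [this, abs_neg]
  exact (abs_coord_le_norm y i).trans_lt hy

/-- Away from the box, the Riesz transform of the oscillation tends to zero in every `L^q`,
at an algebraic rate. -/
lemma exists_lintegral_rieszTransform_compl_le [NeZero n] {c s : Fin n → ℝ} (hs : 0 < s 0)
    {q : ℝ} (hq : 1 ≤ q) (j : Fin n) :
    ∃ C : ENNReal, C ≠ ⊤ ∧ ∀ N : ℕ, 0 < N →
      ∫⁻ x in (halfOpenBox c s)ᶜ, ‖rieszTransform j (boxOsc c s N) x‖ₑ ^ q ≤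
        C * ENNReal.ofReal ((N : ℝ) ^ (-(1 / 4) : ℝ)) := by
  have hq0 : 0 < q := by linarith
  have hθ : 0 < 1 / (4 * q) := by positivity
  -- With `θ = 1 / (4 * q)` the `q`-th power of the local bound is a multiple of
  -- `δ ^ (1 / 4) * r ^ (-1 / 2)`, which is integrable across the faces of the box.
  have hθ1 : 1 / (4 * q) ≤ 1 := by rw [div_le_one (by positivity)]; linarith
  obtain ⟨R₁, hR₁, hbox⟩ := (isBounded_halfOpenBox c s).exists_pos_norm_lt
  set R := R₁ + s 0 with hR
  have hR0 : 0 < R := by positivity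
  have hsupp : ∀ y, R ≤ ‖y‖ → y ∉ halfOpenBox c s := fun y hy hmem => by
    have := hbox y hmem
    linarith
  obtain ⟨C₁, hC₁, hnear⟩ := exists_abs_rieszTransform_le_off_support (n := n) hθ hθ1 (2 * R)
  obtain ⟨C₂, hC₂, hfar⟩ := exists_abs_rieszTransform_le_far (n := n) hR0
  set D := 1 + 1 / (2 * R) with hD
  have hD0 : 0 < D := by positivity
  set K := C₁ ^ q * s 0 ^ (1 / 4 : ℝ) + (C₂ * s 0 * D ^ (n + 1)) ^ q with hK
  have hK0 : 0 ≤ K := by positivity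
  set ψ : ℝ → ℝ → ENNReal := fun w t => ENNReal.ofReal ((1 / |t - w|) ^ (1 / 2 : ℝ)) with hψ
  set U : EuclideanSpace ℝ (Fin n) → ENNReal := fun x =>
    (halfOpenBox (fun _ : Fin n => -(2 * R)) (fun _ => 4 * R)).indicator
      (fun x => ∑ i, (ψ (c i) (x i) + ψ (c i + s i) (x i))) x with hU
  set V : EuclideanSpace ℝ (Fin n) → ENNReal := fun x =>
    ENNReal.ofReal ((1 + ‖x‖) ^ (-(((n : ℝ) + 1) * q))) with hV
  have hψm : ∀ w i, Measurable fun x : EuclideanSpace ℝ (Fin n) => ψ w (x i) :=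
    fun w i => (measurable_singularity _ _ w).comp (by fun_prop)
  have hUm : Measurable U := (Finset.measurable_fun_sum _ fun i _ =>
    (hψm _ i).add (hψm _ i)).indicator (measurableSet_halfOpenBox _ _)
  refine ⟨ENNReal.ofReal K * ((∫⁻ x, U x) + ∫⁻ x, V x), ?_, fun N hN => ?_⟩
  · refine ENNReal.mul_ne_top ENNReal.ofReal_ne_top (ENNReal.add_ne_top.2 ⟨?_, ?_⟩)
    · rw [hU, lintegral_indicator (measurableSet_halfOpenBox _ _),
        lintegral_finsetSum _ (fun i _ => by exact (hψm _ i).add (hψm _ i))]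
      refine ENNReal.sum_ne_top.2 fun i _ => ?_
      rw [lintegral_add_left (hψm _ i)]
      exact ENNReal.add_ne_top.2
        ⟨lintegral_box_singularity_ne_top (by norm_num) one_pos _ _ _ _,
          lintegral_box_singularity_ne_top (by norm_num) one_pos _ _ _ _⟩
    · have hi : Integrable fun x : EuclideanSpace ℝ (Fin n) =>
          (1 + ‖x‖) ^ (-(((n : ℝ) + 1) * q)) := by
        refine integrable_one_add_norm ?_
        simp only [finrank_euclideanSpace, Fintype.card_fin]
        nlinarith [(Nat.cast_nonneg n : (0 : ℝ) ≤ n)]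
      rw [hV, ← ofReal_integral_eq_lintegral_ofReal hi (.of_forall fun x => by positivity)]
      exact ENNReal.ofReal_ne_top
  have hN1 : (1 : ℝ) ≤ N := by exact_mod_cast hN
  have hN0 : (0 : ℝ) < N := by linarith
  set ρ := (N : ℝ) ^ (-(1 / 4) : ℝ) with hρ
  have hρ0 : 0 < ρ := by positivity
  set δ := s 0 / N / 2 with hδ
  have hδ0 : 0 < δ := by positivity
  have hδ1 : δ ≤ s 0 * (N : ℝ) ^ (-1 : ℝ) := by
    rw [Real.rpow_neg_one, ← div_eq_mul_inv]
    have : 0 < s 0 / N := by positivity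
    linarith
  have hv := norm_halfStep hs.le N
  have hvne : halfStep s N ≠ 0 := norm_pos_iff.1 (by rw [hv]; exact hδ0)
  have hδq : ∀ p : ℝ, 1 / 4 ≤ p → δ ^ p ≤ s 0 ^ p * ρ := by
    intro p hp
    refine (Real.rpow_le_rpow hδ0.le hδ1 (by linarith)).trans ?_
    rw [Real.mul_rpow hs.le (by positivity), ← Real.rpow_mul hN0.le]
    gcongr _ * ?_
    exact Real.rpow_le_rpow_of_exponent_le hN1 (by linarith)
  have hsupp' : ∀ y, y ∉ halfOpenBox c s → boxOscPos c s N y = 0 ∧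
      boxOscPos c s N (y - halfStep s N) = 0 :=
    fun y hy => ⟨boxOscPos_eq_zero hs N hy, boxOscPos_sub_eq_zero hs N hy⟩
  have hpt : ∀ᵐ x, x ∈ (halfOpenBox c s)ᶜ → ‖rieszTransform j (boxOsc c s N) x‖ₑ ^ q ≤
      ENNReal.ofReal (K * ρ) * (U x + V x) := by
    filter_upwards [ae_offWalls c s N] with x hx hxbox
    rw [enorm_rpow_eq_ofReal _ hq0.le]
    rcases lt_or_ge ‖x‖ (2 * R) with hxR | hxR
    · obtain ⟨i, r, hr, hcases, hball⟩ := exists_radius_of_notMem_box hxbox hx.2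
      have h1 := hnear j (boxOsc c s N) (boxOscPos c s N) (halfStep s N) x r
        (integrable_boxOscPos hs N) (abs_boxOscPos_le_one hs N) (boxOsc_eq_sub c s N) hvne hr
        (fun y hy => hsupp' y (hsupp y (by linarith))) hxR.le (fun y hy => hsupp' _ (hball y hy))
      rw [hv, ← hδ] at h1
      have h2 : |rieszTransform j (boxOsc c s N) x| ^ q ≤
          (K * ρ) * (1 / r) ^ (1 / 2 : ℝ) := by
        refine (Real.rpow_le_rpow (abs_nonneg _) h1 hq0.le).trans ?_
        rw [Real.mul_rpow (by positivity) (by positivity), Real.mul_rpow hC₁ (by positivity),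
          ← Real.rpow_mul hδ0.le, ← Real.rpow_mul hr.le]
        have e1 : 1 / (4 * q) * q = 1 / 4 := by field_simp
        have e2 : -(2 * (1 / (4 * q))) * q = -(1 / 2) := by field_simp; norm_num
        rw [e1, e2, one_div r, Real.inv_rpow hr.le, ← Real.rpow_neg hr.le]
        gcongr ?_ * _
        calc C₁ ^ q * δ ^ (1 / 4 : ℝ) ≤ C₁ ^ q * (s 0 ^ (1 / 4 : ℝ) * ρ) := by
              gcongr
              exact hδq _ le_rfl
          _ = (C₁ ^ q * s 0 ^ (1 / 4 : ℝ)) * ρ := by ring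
          _ ≤ K * ρ := by
              gcongr
              exact le_add_of_nonneg_right (by positivity)
      refine (ENNReal.ofReal_le_ofReal h2).trans ?_
      rw [ENNReal.ofReal_mul (by positivity)]
      gcongr _ * ?_
      refine le_trans ?_ (le_self_add (b := V x))
      have hxmem : x ∈ halfOpenBox (fun _ : Fin n => -(2 * R)) (fun _ => 4 * R) := fun k => by
        have := abs_lt.1 ((abs_coord_le_norm x k).trans_lt hxR)
        exact ⟨this.1.le, by linarith [this.2]⟩
      simp only [hU]
      rw [Set.indicator_of_mem hxmem]
      refine le_trans ?_ (Finset.single_le_sum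
        (f := fun i => ψ (c i) (x i) + ψ (c i + s i) (x i)) (fun _ _ => zero_le)
        (Finset.mem_univ i))
      rcases hcases with h | h
      · rw [h]; exact le_self_add
      · rw [h]; exact le_add_self
    · have hx0 : 0 < ‖x‖ := by linarith
      have h1 := hfar j (boxOsc c s N) (boxOscPos c s N) (halfStep s N) x
        (integrable_boxOscPos hs N) (abs_boxOscPos_le_one hs N) (boxOsc_eq_sub c s N)
        (by
          have : s 0 / N ≤ s 0 := div_le_self hs.le hN1
          rw [hv]; linarith)
        (fun y hy => hsupp' y (hsupp y hy)) hxR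
      rw [hv, ← hδ] at h1
      have hDx : 1 + ‖x‖ ≤ D * ‖x‖ := by
        have : 1 ≤ 1 / (2 * R) * ‖x‖ := by
          rw [div_mul_eq_mul_div, one_mul, one_le_div (by positivity)]
          exact hxR
        rw [hD, add_mul]
        linarith
      have h3 : C₂ * δ / ‖x‖ ^ (n + 1) ≤
          C₂ * D ^ (n + 1) * δ * (1 + ‖x‖) ^ (-((n : ℝ) + 1)) := by
        rw [Real.rpow_neg (by positivity), show (n : ℝ) + 1 = ((n + 1 : ℕ) : ℝ) by push_cast; ring,
          Real.rpow_natCast, ← div_eq_mul_inv, div_le_div_iff₀ (by positivity) (by positivity)]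
        have := pow_le_pow_left₀ (by positivity) hDx (n + 1)
        rw [mul_pow] at this
        calc C₂ * δ * (1 + ‖x‖) ^ (n + 1) ≤ C₂ * δ * (D ^ (n + 1) * ‖x‖ ^ (n + 1)) := by gcongr
          _ = _ := by ring
      have h2 : |rieszTransform j (boxOsc c s N) x| ^ q ≤
          (K * ρ) * (1 + ‖x‖) ^ (-(((n : ℝ) + 1) * q)) := by
        refine (Real.rpow_le_rpow (abs_nonneg _) (h1.trans h3) hq0.le).trans ?_
        rw [Real.mul_rpow (by positivity) (by positivity), Real.mul_rpow (by positivity) hδ0.le,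
          ← Real.rpow_mul (by positivity), neg_mul]
        gcongr ?_ * _
        calc (C₂ * D ^ (n + 1)) ^ q * δ ^ q ≤ (C₂ * D ^ (n + 1)) ^ q * (s 0 ^ q * ρ) := by
              gcongr
              exact hδq _ (by linarith)
          _ = (C₂ * s 0 * D ^ (n + 1)) ^ q * ρ := by
              rw [← mul_assoc, ← Real.mul_rpow (by positivity) hs.le]
              ring_nf
          _ ≤ K * ρ := by
              gcongr
              exact le_add_of_nonneg_left (by positivity)
      refine (ENNReal.ofReal_le_ofReal h2).trans ?_
      rw [ENNReal.ofReal_mul (by positivity)]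
      gcongr _ * ?_
      exact le_add_self
  refine (setLIntegral_mono_ae' (measurableSet_halfOpenBox c s).compl hpt).trans ?_
  rw [lintegral_const_mul' _ _ ENNReal.ofReal_ne_top]
  calc ENNReal.ofReal (K * ρ) * ∫⁻ x in (halfOpenBox c s)ᶜ, (U x + V x)
      ≤ ENNReal.ofReal (K * ρ) * ∫⁻ x, (U x + V x) := by
        gcongr
        exact Measure.restrict_le_self
    _ = _ := by
        rw [lintegral_add_left hUm, ENNReal.ofReal_mul hK0]
        ring

/-! ### Linearity, symmetry and norm bounds of the Riesz transform -/

lemma stronglyMeasurable_rieszTruncated (j : Fin n) (ε : ℝ) {f : EuclideanSpace ℝ (Fin n) → ℝ}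
    (hf : Measurable f) : StronglyMeasurable (rieszTruncated j ε f) := by
  unfold rieszTruncated
  have : Measurable fun z : EuclideanSpace ℝ (Fin n) × EuclideanSpace ℝ (Fin n) =>
      rieszKernel j z.2 * f (z.1 - z.2) :=
    ((measurable_rieszKernel j).comp measurable_snd).mul
      (hf.comp (measurable_fst.sub measurable_snd))
  exact this.stronglyMeasurable.integral_prod_right'

lemma RieszPVExists.tendsto {j : Fin n} {f : EuclideanSpace ℝ (Fin n) → ℝ}
    {x : EuclideanSpace ℝ (Fin n)} (h : RieszPVExists j f x) :
    Tendsto (fun ε => rieszTruncated j ε f x) (𝓝[>] (0 : ℝ)) (𝓝 (rieszTransform j f x)) :=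
  tendsto_nhds_limUnder h.2

lemma aestronglyMeasurable_rieszTransform {j : Fin n} {f : EuclideanSpace ℝ (Fin n) → ℝ}
    (hf : Measurable f) (h : ∀ᵐ x, RieszPVExists j f x) :
    AEStronglyMeasurable (rieszTransform j f) := by
  have hε : Tendsto (fun k : ℕ => 1 / ((k : ℝ) + 1)) atTop (𝓝[>] 0) :=
    tendsto_nhdsWithin_iff.2 ⟨tendsto_one_div_add_atTop_nhds_zero_nat,
      .of_forall fun k => by simp only [Set.mem_Ioi]; positivity⟩
  refine aestronglyMeasurable_of_tendsto_ae atTop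
    (f := fun (k : ℕ) => rieszTruncated j (1 / ((k : ℝ) + 1)) f)
    (fun k => (stronglyMeasurable_rieszTruncated j _ hf).aestronglyMeasurable) ?_
  filter_upwards [h] with x hx using hx.tendsto.comp hε

lemma rieszTransform_sum {ι : Type*} (S : Finset ι) {j : Fin n}
    {f : EuclideanSpace ℝ (Fin n) → ℝ} {g : ι → EuclideanSpace ℝ (Fin n) → ℝ}
    (hfg : ∀ y, f y = ∑ i ∈ S, g i y) {x : EuclideanSpace ℝ (Fin n)}
    (h : ∀ i ∈ S, RieszPVExists j (g i) x) :
    rieszTransform j f x = ∑ i ∈ S, rieszTransform j (g i) x := by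
  refine Tendsto.limUnder_eq ?_
  refine (tendsto_finsetSum S fun i hi => (h i hi).tendsto).congr' ?_
  filter_upwards [self_mem_nhdsWithin] with ε hε
  unfold rieszTruncated
  rw [← integral_finsetSum S fun i hi => (h i hi).1 ε hε]
  simp_rw [hfg, Finset.mul_sum]

/-- The isometry of `ℝⁿ` changing the sign of the first coordinate. -/
def negFirst (n : ℕ) [NeZero n] : EuclideanSpace ℝ (Fin n) ≃ₗᵢ[ℝ] EuclideanSpace ℝ (Fin n) :=
  LinearIsometryEquiv.piLpCongrRight 2
    (fun i => if i = 0 then LinearIsometryEquiv.neg ℝ else LinearIsometryEquiv.refl ℝ ℝ)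

lemma negFirst_zero [NeZero n] (x : EuclideanSpace ℝ (Fin n)) : negFirst n x 0 = -x 0 := by
  simp [negFirst]

lemma negFirst_of_ne [NeZero n] (x : EuclideanSpace ℝ (Fin n)) {i : Fin n} (hi : i ≠ 0) :
    negFirst n x i = x i := by
  simp [negFirst, hi]

/-- The reflection of `ℝⁿ` in the hyperplane `x 0 = m`. -/
def reflectFirst [NeZero n] (m : ℝ) (x : EuclideanSpace ℝ (Fin n)) : EuclideanSpace ℝ (Fin n) :=
  EuclideanSpace.single 0 (2 * m) + negFirst n x

lemma reflectFirst_zero [NeZero n] (m : ℝ) (x : EuclideanSpace ℝ (Fin n)) :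
    reflectFirst m x 0 = 2 * m - x 0 := by
  simp [reflectFirst, negFirst_zero, sub_eq_add_neg]

lemma reflectFirst_of_ne [NeZero n] (m : ℝ) (x : EuclideanSpace ℝ (Fin n)) {i : Fin n}
    (hi : i ≠ 0) : reflectFirst m x i = x i := by
  simp [reflectFirst, negFirst_of_ne x hi, hi]

lemma measurePreserving_reflectFirst [NeZero n] (m : ℝ) :
    MeasurePreserving (reflectFirst (n := n) m) :=
  (measurePreserving_add_left volume _).comp (negFirst n).measurePreserving

lemma measurableEmbedding_reflectFirst [NeZero n] (m : ℝ) :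
    MeasurableEmbedding (reflectFirst (n := n) m) :=
  (measurableEmbedding_addLeft _).comp (negFirst n).toHomeomorph.measurableEmbedding

lemma rieszKernel_negFirst [NeZero n] (y : EuclideanSpace ℝ (Fin n)) :
    rieszKernel 0 (negFirst n y) = -rieszKernel 0 y := by
  rw [rieszKernel_eq, rieszKernel_eq, negFirst_zero, LinearIsometryEquiv.norm_map, neg_div, mul_neg]

/-- The first Riesz transform anticommutes with reflections in the first coordinate, so it maps
odd functions to even ones. -/
lemma rieszTransform_reflectFirst [NeZero n] {f : EuclideanSpace ℝ (Fin n) → ℝ} {m : ℝ}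
    (hf : ∀ᵐ x, f (reflectFirst m x) = -f x) (x : EuclideanSpace ℝ (Fin n)) :
    rieszTransform 0 f (reflectFirst m x) = rieszTransform 0 f x := by
  have key : ∀ ε, rieszTruncated 0 ε f (reflectFirst m x) = rieszTruncated 0 ε f x := by
    intro ε
    unfold rieszTruncated
    rw [← integral_indicator (measurableSet_norm_lt ε), ← integral_indicator
      (measurableSet_norm_lt ε), ← (negFirst n).measurePreserving.integral_comp
        (negFirst n).toHomeomorph.measurableEmbedding]
    refine integral_congr_ae ?_
    filter_upwards [(quasiMeasurePreserving_sub_left volume x).ae hf] with y hy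
    have e : reflectFirst m x - negFirst n y = reflectFirst m (x - y) := by
      rw [reflectFirst, reflectFirst, map_sub]
      abel
    by_cases h : ε < ‖y‖
    · rw [Set.indicator_of_mem (by simpa using h), Set.indicator_of_mem (by simpa using h), e, hy,
        rieszKernel_negFirst]
      ring
    · rw [Set.indicator_of_notMem (by simpa using h), Set.indicator_of_notMem (by simpa using h)]
  unfold rieszTransform
  simp_rw [key]

lemma haarSign_add (a h t d : ℝ) : haarSign (a + d) h (t + d) = haarSign a h t := by
  have key : ∀ u v : ℝ, t + d ∈ Set.Ico (u + d) (v + d) ↔ t ∈ Set.Ico u v := by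
    simp [Set.mem_Ico]
  classical
  simp only [haarSign, Set.indicator_apply, Pi.one_apply, add_right_comm a d, key]

lemma haarSign_reflect {a h t : ℝ} (h0 : t ≠ a) (h1 : t ≠ a + h / 2) (h2 : t ≠ a + h) :
    haarSign a h (2 * (a + h / 2) - t) = -haarSign a h t := by
  have e1 : 2 * (a + h / 2) - t ∈ Set.Ico a (a + h / 2) ↔ t ∈ Set.Ico (a + h / 2) (a + h) := by
    simp only [Set.mem_Ico]
    constructor
    · rintro ⟨h3, h4⟩
      exact ⟨by linarith, lt_of_le_of_ne (by linarith) h2⟩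
    · rintro ⟨h3, h4⟩
      have := lt_of_le_of_ne h3 h1.symm
      exact ⟨by linarith, by linarith⟩
  have e2 : 2 * (a + h / 2) - t ∈ Set.Ico (a + h / 2) (a + h) ↔ t ∈ Set.Ico a (a + h / 2) := by
    simp only [Set.mem_Ico]
    constructor
    · rintro ⟨h3, h4⟩
      exact ⟨by linarith, lt_of_le_of_ne (by linarith) h1⟩
    · rintro ⟨h3, h4⟩
      have := lt_of_le_of_ne h3 h0.symm
      exact ⟨by linarith, by linarith⟩
  classical
  simp only [haarSign, Set.indicator_apply, e1, e2, Pi.one_apply, neg_sub]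

/-- `boxOsc` is odd about the centre of the box. -/
lemma ae_boxOsc_reflectFirst [NeZero n] (c s : Fin n → ℝ) {N : ℕ} (hN : 0 < N) :
    ∀ᵐ x, boxOsc c s N (reflectFirst (c 0 + s 0 / 2) x) = -boxOsc c s N x := by
  filter_upwards [ae_offWalls c s N] with x hx
  have hcyl : reflectFirst (c 0 + s 0 / 2) x ∈ boxCylinder c s ↔ x ∈ boxCylinder c s :=
    forall_congr' fun i => forall_congr' fun hi => by rw [reflectFirst_of_ne _ _ hi]
  have e1 : (boxCylinder c s).indicator (1 : EuclideanSpace ℝ (Fin n) → ℝ)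
      (reflectFirst (c 0 + s 0 / 2) x) = (boxCylinder c s).indicator 1 x := by
    classical simp only [Set.indicator_apply, hcyl, Pi.one_apply]
  rw [boxOsc, boxOsc, e1, ← neg_mul, ← Finset.sum_neg_distrib, reflectFirst_zero,
    ← Finset.sum_range_reflect]
  congr 1
  refine Finset.sum_congr rfl fun i hi => ?_
  have hi' := Finset.mem_range.1 hi
  set h := s 0 / N with hh
  have hNh : (N : ℝ) * h = s 0 := mul_div_cancel₀ _ (by positivity)
  have hcast : ((N - 1 - i : ℕ) : ℝ) = N - 1 - i := by
    rw [Nat.cast_sub (by omega), Nat.cast_sub hN, Nat.cast_one]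
  have w : ∀ l : ℕ, l ≤ 2 * N → x 0 ≠ c 0 + l * (h / 2) := fun l hl =>
    hx.1 l (Finset.mem_range.2 (by omega))
  have w0 := w (2 * i) (by omega)
  have w1 := w (2 * i + 1) (by omega)
  have w2 := w (2 * i + 2) (by omega)
  push_cast at w0 w1 w2
  rw [← haarSign_reflect (a := c 0 + i * h) (h := h) (t := x 0) (by convert w0 using 1; ring)
    (by convert w1 using 1; ring) (by convert w2 using 1; ring), hcast,
    ← haarSign_add (c 0 + i * h) h _ ((N - 1 - 2 * i) * h)]
  congr 1
  · ring
  · rw [← hNh]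
    ring

lemma exists_lintegral_rieszTransform_le [NeZero n] {c s : Fin n → ℝ} (hs : 0 < s 0)
    {q : ℝ} (hq : 1 ≤ q) (j : Fin n) :
    ∃ C : ENNReal, C ≠ ⊤ ∧ ∀ N : ℕ, 0 < N →
      ∫⁻ x, ‖rieszTransform j (boxOsc c s N) x‖ₑ ^ q ≤ C := by
  obtain ⟨C₁, hC₁, h1⟩ := exists_lintegral_rieszTransform_box_le (c := c) hs
    (zero_lt_one.trans_le hq) j
  obtain ⟨C₂, hC₂, h2⟩ := exists_lintegral_rieszTransform_compl_le (c := c) hs hq j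
  refine ⟨C₁ + C₂, ENNReal.add_ne_top.2 ⟨hC₁, hC₂⟩, fun N hN => ?_⟩
  rw [← lintegral_add_compl _ (measurableSet_halfOpenBox c s)]
  refine add_le_add (h1 N hN) ((h2 N hN).trans ?_)
  refine mul_le_of_le_one_right' ?_
  rw [ENNReal.ofReal_le_one]
  exact Real.rpow_le_one_of_one_le_of_nonpos (by exact_mod_cast hN) (by norm_num)

/-- Uniform `L^q` bounds for the Riesz transforms of the oscillations. -/
lemma exists_eLpNorm_rieszTransform_le [NeZero n] {c s : Fin n → ℝ} (hs : 0 < s 0)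
    {q : ℝ} (hq : 1 ≤ q) (j : Fin n) :
    ∃ C : ENNReal, C ≠ ⊤ ∧ ∀ N : ℕ, 0 < N →
      eLpNorm (rieszTransform j (boxOsc c s N)) (ENNReal.ofReal q) ≤ C := by
  have hq0 : 0 < q := by linarith
  obtain ⟨C, hC, h⟩ := exists_lintegral_rieszTransform_le (c := c) hs hq j
  refine ⟨C ^ (1 / q), ENNReal.rpow_ne_top_of_nonneg (by positivity) hC, fun N hN => ?_⟩
  rw [eLpNorm_eq_lintegral_rpow_enorm_toReal (by simpa using hq0) ENNReal.ofReal_ne_top,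
    ENNReal.toReal_ofReal hq0.le]
  gcongr
  exact h N hN

lemma tendsto_eLpNorm_rieszTransform_compl [NeZero n] {c s : Fin n → ℝ} (hs : 0 < s 0)
    {q : ℝ} (hq : 1 ≤ q) (j : Fin n) :
    Tendsto (fun N : ℕ => eLpNorm (rieszTransform j (boxOsc c s N)) (ENNReal.ofReal q)
      (volume.restrict (halfOpenBox c s)ᶜ)) atTop (𝓝 0) := by
  have hq0 : 0 < q := by linarith
  obtain ⟨C, hC, h⟩ := exists_lintegral_rieszTransform_compl_le (c := c) hs hq j
  have h1 : Tendsto (fun N : ℕ => ENNReal.ofReal ((N : ℝ) ^ (-(1 / 4) : ℝ))) atTop (𝓝 0) := by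
    rw [← ENNReal.ofReal_zero]
    exact ENNReal.tendsto_ofReal
      ((tendsto_rpow_neg_atTop (by norm_num)).comp tendsto_natCast_atTop_atTop)
  have h2 : Tendsto (fun N : ℕ => (C * ENNReal.ofReal ((N : ℝ) ^ (-(1 / 4) : ℝ))) ^ (1 / q))
      atTop (𝓝 0) := by
    have h3 := ENNReal.Tendsto.const_mul h1 (Or.inr hC)
    rw [mul_zero] at h3
    have h4 := (ENNReal.continuous_rpow_const (y := 1 / q)).tendsto 0
    rw [ENNReal.zero_rpow_of_pos (by positivity)] at h4
    exact h4.comp h3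
  refine tendsto_of_tendsto_of_tendsto_of_le_of_le' tendsto_const_nhds h2
    (.of_forall fun _ => zero_le) ?_
  filter_upwards [eventually_gt_atTop 0] with N hN
  rw [eLpNorm_eq_lintegral_rpow_enorm_toReal (by simpa using hq0) ENNReal.ofReal_ne_top,
    ENNReal.toReal_ofReal hq0.le]
  gcongr
  exact h N hN

lemma memLp_rieszTransform_boxOsc [NeZero n] {c s : Fin n → ℝ} (hs : 0 < s 0)
    {q : ℝ} (hq : 1 ≤ q) (j : Fin n) {N : ℕ} (hN : 0 < N) :
    MemLp (rieszTransform j (boxOsc c s N)) (ENNReal.ofReal q) := by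
  obtain ⟨C, hC, h⟩ := exists_eLpNorm_rieszTransform_le (c := c) hs hq j
  exact ⟨aestronglyMeasurable_rieszTransform (measurable_boxOsc c s N)
    (ae_rieszPVExists_boxOsc hs hN j), (h N hN).trans_lt hC.lt_top⟩

lemma integrable_rieszTransform_boxOsc_pow [NeZero n] {c s : Fin n → ℝ} (hs : 0 < s 0)
    {e : ℕ} (he : 1 ≤ e) (j : Fin n) {N : ℕ} (hN : 0 < N) :
    Integrable fun x => rieszTransform j (boxOsc c s N) x ^ e := by
  have h := memLp_rieszTransform_boxOsc (c := c) hs (q := e) (by exact_mod_cast he) j hN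
  rw [ENNReal.ofReal_natCast] at h
  refine (integrable_norm_iff (h.1.pow e)).1 ?_
  simpa only [Pi.pow_apply, norm_pow] using h.integrable_norm_pow (by omega)

lemma exists_integral_abs_rieszTransform_pow_le [NeZero n] {c s : Fin n → ℝ} (hs : 0 < s 0)
    {e : ℕ} (he : 1 ≤ e) (j : Fin n) :
    ∃ A : ℝ, 0 ≤ A ∧ ∀ N : ℕ, 0 < N →
      ∫ x, |rieszTransform j (boxOsc c s N) x ^ e| ≤ A := by
  obtain ⟨C, hC, h⟩ := exists_lintegral_rieszTransform_le (c := c) hs (q := e)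
    (by exact_mod_cast he) j
  refine ⟨C.toReal, ENNReal.toReal_nonneg, fun N hN => ?_⟩
  simp_rw [← Real.norm_eq_abs]
  rw [integral_norm_eq_lintegral_enorm
    (integrable_rieszTransform_boxOsc_pow hs he j hN).aestronglyMeasurable]
  refine ENNReal.toReal_mono hC ((lintegral_congr fun x => ?_).trans_le (h N hN))
  rw [enorm_pow, ENNReal.rpow_natCast]

/-! ### Weak convergence and subdivision into slabs -/

lemma eLpNorm_mul_le_mul_eLpNorm_two_mul {X : Type*} {mX : MeasurableSpace X} {μ : Measure X}
    {p : ℝ} (hp : 0 < p) {f g : X → ℝ} (hf : AEStronglyMeasurable f μ)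
    (hg : AEStronglyMeasurable g μ) :
    eLpNorm (fun x => f x * g x) (ENNReal.ofReal p) μ ≤
      eLpNorm f (ENNReal.ofReal (2 * p)) μ * eLpNorm g (ENNReal.ofReal (2 * p)) μ := by
  have : Real.HolderTriple (2 * p) (2 * p) p :=
    ⟨by field_simp; norm_num, by positivity, by positivity⟩
  have h := eLpNorm_smul_le_mul_eLpNorm hg hf (hpqr := this.ennrealOfReal)
  rw [smul_eq_mul] at h
  exact h

/-- Hölder's inequality for the pairing of `L^p` with its dual. -/
lemma enorm_integral_mul_le {p : ℝ} (hp : 1 < p) {f b : EuclideanSpace ℝ (Fin n) → ℝ}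
    (hf : AEStronglyMeasurable f) (hb : AEStronglyMeasurable b) :
    ‖∫ x, f x * b x‖ₑ ≤
      eLpNorm f (ENNReal.ofReal p) * eLpNorm b (ENNReal.ofReal (p / (p - 1))) := by
  have h := eLpNorm_smul_le_mul_eLpNorm hb hf (r := 1)
    (hpqr := (Real.HolderConjugate.conjExponent hp).ennrealOfReal)
  refine (enorm_integral_le_lintegral_enorm _).trans ?_
  rw [← eLpNorm_one_eq_lintegral_enorm]
  rw [smul_eq_mul, Real.conjExponent] at h
  exact h

/-- Strong convergence implies weak convergence. -/
lemma weaklyTendstoZero_of_tendsto_eLpNorm {p : ℝ} (hp : 1 < p)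
    {F : ℕ → EuclideanSpace ℝ (Fin n) → ℝ} (hF : ∀ k, MemLp (F k) (ENNReal.ofReal p))
    (h : Tendsto (fun k => eLpNorm (F k) (ENNReal.ofReal p)) atTop (𝓝 0)) :
    WeaklyTendstoZero p F := by
  refine ⟨hF, fun b hb => ?_⟩
  rw [tendsto_iff_edist_tendsto_0]
  simp_rw [edist_zero_right]
  have h1 := ENNReal.Tendsto.mul_const h (Or.inr hb.2.ne)
  rw [zero_mul] at h1
  exact tendsto_of_tendsto_of_tendsto_of_le_of_le tendsto_const_nhds h1 (fun _ => zero_le)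
    fun k => enorm_integral_mul_le hp (hF k).1 hb.1

/-- For a bounded sequence in `L^p`, weak convergence may be tested on continuous compactly
supported functions. -/
lemma weaklyTendstoZero_of_forall_continuous {p : ℝ} (hp : 1 < p)
    {F : ℕ → EuclideanSpace ℝ (Fin n) → ℝ} (hF : ∀ k, MemLp (F k) (ENNReal.ofReal p))
    {C : ENNReal} (hC : C ≠ ⊤) (hFC : ∀ k, eLpNorm (F k) (ENNReal.ofReal p) ≤ C)
    (h : ∀ g : EuclideanSpace ℝ (Fin n) → ℝ, Continuous g → HasCompactSupport g →
      Tendsto (fun k => ∫ x, F k x * g x) atTop (𝓝 0)) :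
    WeaklyTendstoZero p F := by
  have hconj := (Real.HolderConjugate.conjExponent hp).ennrealOfReal
  refine ⟨hF, fun b hb => ?_⟩
  rw [tendsto_iff_edist_tendsto_0]
  simp_rw [edist_zero_right]
  rw [ENNReal.tendsto_nhds_zero]
  intro η hη
  have hη2 : 0 < η / 2 := ENNReal.half_pos hη.ne'
  obtain ⟨ε, hε, hCε⟩ : ∃ ε : ENNReal, ε ≠ 0 ∧ C * ε ≤ η / 2 :=
    ⟨η / 2 / (C + 1), (ENNReal.div_pos hη2.ne' (by simp [hC])).ne', by
      rw [mul_comm]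
      exact (mul_le_mul_right (le_self_add (b := 1)) _).trans
        (ENNReal.div_mul_cancel (by simp) (by simp [hC])).le⟩
  obtain ⟨g, hgc, hbg, hg, hgm⟩ := hb.exists_hasCompactSupport_eLpNorm_sub_le
    ENNReal.ofReal_ne_top hε
  have h1 := h g hg hgc
  rw [tendsto_iff_edist_tendsto_0] at h1
  simp_rw [edist_zero_right] at h1
  filter_upwards [ENNReal.tendsto_nhds_zero.1 h1 _ hη2] with k hk
  have hint : ∀ u : EuclideanSpace ℝ (Fin n) → ℝ, MemLp u (ENNReal.ofReal (p / (p - 1))) →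
      Integrable fun x => F k x * u x := fun u hu =>
    memLp_one_iff_integrable.1 (MemLp.mul (r := 1) (p := ENNReal.ofReal p)
      (q := ENNReal.ofReal (p / (p - 1))) hu (hF k) (hpqr := hconj))
  have e : ∫ x, F k x * b x = (∫ x, F k x * (b - g) x) + ∫ x, F k x * g x := by
    rw [← integral_add (hint _ (hb.sub hgm)) (hint _ hgm)]
    congr 1
    ext x
    simp only [Pi.sub_apply]
    ring
  rw [e]
  refine (enorm_add_le _ _).trans ?_
  calc ‖∫ x, F k x * (b - g) x‖ₑ + ‖∫ x, F k x * g x‖ₑ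
      ≤ C * ε + η / 2 := by
        refine add_le_add ((enorm_integral_mul_le hp (hF k).1 (hb.sub hgm).1).trans ?_) hk
        gcongr
        exact hFC k
    _ ≤ η / 2 + η / 2 := by gcongr
    _ = η := ENNReal.add_halves η

/-- The corner of the `i`-th of the `M` slabs of equal width into which a box is divided in the
first coordinate. -/
def slabCorner [NeZero n] (c s : Fin n → ℝ) (M i : ℕ) : Fin n → ℝ :=
  Function.update c 0 (c 0 + i * (s 0 / M))

/-- The side lengths of the `M` slabs of equal width into which a box is divided in the first
coordinate. -/
def slabSide [NeZero n] (s : Fin n → ℝ) (M : ℕ) : Fin n → ℝ :=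
  Function.update s 0 (s 0 / M)

lemma slabCorner_zero [NeZero n] (c s : Fin n → ℝ) (M i : ℕ) :
    slabCorner c s M i 0 = c 0 + i * (s 0 / M) := by simp [slabCorner]

lemma slabSide_zero [NeZero n] (s : Fin n → ℝ) (M : ℕ) : slabSide s M 0 = s 0 / M := by
  simp [slabSide]

lemma slabSide_pos [NeZero n] {s : Fin n → ℝ} (hs : 0 < s 0) {M : ℕ} (hM : 0 < M) :
    0 < slabSide s M 0 := by
  rw [slabSide_zero]
  positivity

lemma boxCylinder_slab [NeZero n] (c s : Fin n → ℝ) (M i : ℕ) :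
    boxCylinder (slabCorner c s M i) (slabSide s M) = boxCylinder c s := by
  ext x
  refine forall_congr' fun k => forall_congr' fun hk => ?_
  simp [slabCorner, slabSide, hk]

lemma sum_range_mul_eq (φ : ℕ → ℝ) (M N : ℕ) :
    ∑ l ∈ Finset.range (M * N), φ l =
      ∑ i ∈ Finset.range M, ∑ j ∈ Finset.range N, φ (i * N + j) := by
  induction M with
  | zero => simp
  | succ M ih => rw [Nat.succ_mul, Finset.sum_range_add, ih, Finset.sum_range_succ]

/-- The oscillation on a box is the sum of the oscillations on its slabs. -/
lemma boxOsc_eq_sum_slab [NeZero n] (c s : Fin n → ℝ) (M : ℕ) {N : ℕ} (hN : 0 < N)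
    (x : EuclideanSpace ℝ (Fin n)) :
    boxOsc c s (M * N) x =
      ∑ i ∈ Finset.range M, boxOsc (slabCorner c s M i) (slabSide s M) N x := by
  simp only [boxOsc, boxCylinder_slab, slabCorner_zero, slabSide_zero]
  rw [← Finset.sum_mul, sum_range_mul_eq]
  congr 1
  refine Finset.sum_congr rfl fun i _ => Finset.sum_congr rfl fun j _ => ?_
  have e : s 0 / ((M * N : ℕ) : ℝ) = s 0 / M / N := by rw [div_div]; push_cast; rfl
  rw [e]
  congr 1
  have : (N : ℝ) * (s 0 / M / N) = s 0 / M := mul_div_cancel₀ _ (by positivity)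
  push_cast
  rw [add_mul, mul_assoc, this]
  ring

lemma mem_slab_zero [NeZero n] {c s : Fin n → ℝ} {M i : ℕ} {x : EuclideanSpace ℝ (Fin n)}
    (hx : x ∈ halfOpenBox (slabCorner c s M i) (slabSide s M)) :
    x 0 ∈ Set.Ico (c 0 + i * (s 0 / M)) (c 0 + (i + 1) * (s 0 / M)) := by
  have := hx 0
  rw [slabCorner_zero, slabSide_zero] at this
  rwa [add_mul, one_mul, ← add_assoc]

lemma slab_subset_compl [NeZero n] {c s : Fin n → ℝ} (hs : 0 < s 0) {M i j : ℕ} (hij : i ≠ j) :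
    halfOpenBox (slabCorner c s M i) (slabSide s M) ⊆
      (halfOpenBox (slabCorner c s M j) (slabSide s M))ᶜ := by
  have key : ∀ i j : ℕ, i < j → ∀ x : EuclideanSpace ℝ (Fin n),
      x ∈ halfOpenBox (slabCorner c s M i) (slabSide s M) →
      x ∉ halfOpenBox (slabCorner c s M j) (slabSide s M) := by
    intro i j hij x hx hx'
    have h1 := (mem_slab_zero hx).2
    have h2 := (mem_slab_zero hx').1
    have h3 : ((i : ℝ) + 1) ≤ j := by exact_mod_cast hij
    have h4 : ((i : ℝ) + 1) * (s 0 / M) ≤ j * (s 0 / M) := by gcongr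
    linarith
  intro x hx hx'
  rcases lt_or_gt_of_ne hij with h | h
  · exact key i j h x hx hx'
  · exact key j i h x hx' hx

lemma sum_abs_boxOsc_slab_le [NeZero n] {c s : Fin n → ℝ} (hs : 0 < s 0) {M : ℕ} (hM : 0 < M)
    (N : ℕ) (x : EuclideanSpace ℝ (Fin n)) :
    ∑ i ∈ Finset.range M, |boxOsc (slabCorner c s M i) (slabSide s M) N x| ≤ 1 := by
  have h1 : ∑ i ∈ Finset.range M, |boxOsc (slabCorner c s M i) (slabSide s M) N x| ≤
      ∑ i ∈ Finset.range M, (Set.Ico (c 0 + i * (s 0 / M))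
        (c 0 + (i + 1) * (s 0 / M))).indicator (1 : ℝ → ℝ) (x 0) := by
    refine Finset.sum_le_sum fun i _ => ?_
    by_cases hx : x ∈ halfOpenBox (slabCorner c s M i) (slabSide s M)
    · rw [Set.indicator_of_mem (mem_slab_zero hx)]
      exact abs_boxOsc_le_one (slabSide_pos hs hM) N x
    · rw [boxOsc_eq_zero (slabSide_pos hs hM) N hx, abs_zero]
      exact Set.indicator_nonneg (fun _ _ => zero_le_one) _
  refine h1.trans ?_
  rw [sum_indicator_Ico _ _ (by positivity)]
  exact Set.indicator_apply_le' (fun _ => le_rfl) fun _ => zero_le_one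

/-- Odd times even functions integrate to zero: the oscillation is odd about the centre of the
box, its Riesz transform is even. -/
lemma integral_boxOsc_mul_eq_zero [NeZero n] (c s : Fin n → ℝ) {N : ℕ} (hN : 0 < N) (e : ℕ)
    {u : EuclideanSpace ℝ (Fin n) → ℝ} (hu : ∀ x, u (reflectFirst (c 0 + s 0 / 2) x) = u x) :
    ∫ x, boxOsc c s N x * rieszTransform 0 (boxOsc c s N) x ^ e * u x = 0 := by
  have h := (measurePreserving_reflectFirst (n := n) (c 0 + s 0 / 2)).integral_comp
    (measurableEmbedding_reflectFirst _)
    (fun x => boxOsc c s N x * rieszTransform 0 (boxOsc c s N) x ^ e * u x)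
  have hodd := ae_boxOsc_reflectFirst c s hN
  have h2 : ∫ x, boxOsc c s N (reflectFirst (c 0 + s 0 / 2) x) *
      rieszTransform 0 (boxOsc c s N) (reflectFirst (c 0 + s 0 / 2) x) ^ e *
        u (reflectFirst (c 0 + s 0 / 2) x) =
      ∫ x, -(boxOsc c s N x * rieszTransform 0 (boxOsc c s N) x ^ e * u x) := by
    refine integral_congr_ae ?_
    filter_upwards [hodd] with x hx
    rw [hx, rieszTransform_reflectFirst hodd, hu]
    ring
  rw [h2, integral_neg] at h
  linarith

/-- On one slab, the Riesz transform of the whole oscillation differs from that of the slab by a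
term vanishing in `L²`. -/
lemma tendsto_eLpNorm_rieszTransform_sub_slab [NeZero n] {c s : Fin n → ℝ} (hs : 0 < s 0)
    {M i : ℕ} (hi : i < M) (j : Fin n) {q : ℝ} (hq : 1 ≤ q) :
    Tendsto (fun N : ℕ => eLpNorm (fun x => rieszTransform j (boxOsc c s (M * N)) x -
        rieszTransform j (boxOsc (slabCorner c s M i) (slabSide s M) N) x) (ENNReal.ofReal q)
      (volume.restrict (halfOpenBox (slabCorner c s M i) (slabSide s M)))) atTop (𝓝 0) := by
  have hM : 0 < M := by omega
  have hs' : 0 < slabSide s M 0 := slabSide_pos hs hM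
  have hlim : Tendsto (fun N : ℕ => ∑ l ∈ (Finset.range M).erase i,
      eLpNorm (rieszTransform j (boxOsc (slabCorner c s M l) (slabSide s M) N)) (ENNReal.ofReal q)
        (volume.restrict (halfOpenBox (slabCorner c s M l) (slabSide s M))ᶜ)) atTop (𝓝 0) := by
    have := tendsto_finsetSum ((Finset.range M).erase i) fun l _ =>
      tendsto_eLpNorm_rieszTransform_compl (c := slabCorner c s M l) hs' hq j
    simpa only [Finset.sum_const_zero] using this
  refine tendsto_of_tendsto_of_tendsto_of_le_of_le' tendsto_const_nhds hlim
    (.of_forall fun _ => zero_le) ?_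
  filter_upwards [eventually_gt_atTop 0] with N hN
  have hpv : ∀ᵐ x, ∀ l, RieszPVExists j (boxOsc (slabCorner c s M l) (slabSide s M) N) x :=
    ae_all_iff.2 fun l => ae_rieszPVExists_boxOsc hs' hN j
  have hae : (fun x => rieszTransform j (boxOsc c s (M * N)) x -
      rieszTransform j (boxOsc (slabCorner c s M i) (slabSide s M) N) x) =ᵐ[volume]
      ∑ l ∈ (Finset.range M).erase i,
        rieszTransform j (boxOsc (slabCorner c s M l) (slabSide s M) N) := by
    filter_upwards [hpv] with x hx
    rw [rieszTransform_sum (Finset.range M) (boxOsc_eq_sum_slab c s M hN) fun l _ => hx l,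
      Finset.sum_apply, ← Finset.add_sum_erase _ _ (Finset.mem_range.2 hi), add_sub_cancel_left]
  rw [eLpNorm_congr_ae (ae_restrict_of_ae hae)]
  refine (eLpNorm_sum_le (fun l _ => (memLp_rieszTransform_boxOsc hs' hq j hN).1.restrict)
    (by simpa using hq)).trans ?_
  refine Finset.sum_le_sum fun l hl => eLpNorm_mono_measure _ (Measure.restrict_mono ?_ le_rfl)
  exact slab_subset_compl hs (Finset.ne_of_mem_erase hl).symm

/-! ### The diagonal case -/

lemma tendsto_eLpNorm_rieszTransform_pow_sub_slab [NeZero n] {c s : Fin n → ℝ} (hs : 0 < s 0)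
    {M i : ℕ} (hi : i < M) (j : Fin n) {e : ℕ} (he : e = 1 ∨ e = 2) :
    Tendsto (fun N : ℕ => eLpNorm (fun x => rieszTransform j (boxOsc c s (M * N)) x ^ e -
        rieszTransform j (boxOsc (slabCorner c s M i) (slabSide s M) N) x ^ e) (ENNReal.ofReal 1)
      (volume.restrict (halfOpenBox (slabCorner c s M i) (slabSide s M)))) atTop (𝓝 0) := by
  have hM : 0 < M := by omega
  have hs' : 0 < slabSide s M 0 := slabSide_pos hs hM
  rcases he with rfl | rfl
  · simpa only [pow_one] using tendsto_eLpNorm_rieszTransform_sub_slab hs hi j le_rfl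
  obtain ⟨C₁, hC₁, h1⟩ := exists_eLpNorm_rieszTransform_le (c := c) hs (q := 2 * 1)
    (by norm_num) j
  obtain ⟨C₂, hC₂, h2⟩ := exists_eLpNorm_rieszTransform_le (c := slabCorner c s M i) hs'
    (q := 2 * 1) (by norm_num) j
  have hlim := ENNReal.Tendsto.mul_const (tendsto_eLpNorm_rieszTransform_sub_slab (c := c) hs hi j
    (q := 2 * 1) (by norm_num)) (Or.inr (ENNReal.add_ne_top.2 ⟨hC₁, hC₂⟩))
  rw [zero_mul] at hlim
  refine tendsto_of_tendsto_of_tendsto_of_le_of_le' tendsto_const_nhds hlim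
    (.of_forall fun _ => zero_le) ?_
  filter_upwards [eventually_gt_atTop 0] with N hN
  have hMN : 0 < M * N := by positivity
  have m1 := (memLp_rieszTransform_boxOsc (c := c) hs (q := 2 * 1) (by norm_num) j hMN).1
  have m2 := (memLp_rieszTransform_boxOsc (c := slabCorner c s M i) hs' (q := 2 * 1)
    (by norm_num) j hN).1
  have hfac : (fun x => rieszTransform j (boxOsc c s (M * N)) x ^ 2 -
      rieszTransform j (boxOsc (slabCorner c s M i) (slabSide s M) N) x ^ 2) =
      fun x => (rieszTransform j (boxOsc c s (M * N)) x -
        rieszTransform j (boxOsc (slabCorner c s M i) (slabSide s M) N) x) *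
        (rieszTransform j (boxOsc c s (M * N)) +
          rieszTransform j (boxOsc (slabCorner c s M i) (slabSide s M) N)) x := by
    ext x
    simp only [Pi.add_apply]
    ring
  rw [hfac]
  refine (eLpNorm_mul_le_mul_eLpNorm_two_mul one_pos (m1.sub m2).restrict
    (m1.add m2).restrict).trans (mul_le_mul' le_rfl ?_)
  refine (eLpNorm_mono_measure _ Measure.restrict_le_self).trans
    ((eLpNorm_add_le m1 m2 (by simp)).trans (add_le_add (h1 _ hMN) (h2 _ hN)))

/-- On a slab, the oscillation times a power of the Riesz transform is asymptotically orthogonal to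
functions which are even about the centre of the slab. -/
lemma tendsto_integral_slab_mul_even [NeZero n] {c s : Fin n → ℝ} (hs : 0 < s 0)
    {M i : ℕ} (hi : i < M) {e : ℕ} (he : e = 1 ∨ e = 2) {u : EuclideanSpace ℝ (Fin n) → ℝ}
    (hum : Measurable u) {B : ℝ} (hB : ∀ x, |u x| ≤ B)
    (hu : ∀ x, u (reflectFirst (slabCorner c s M i 0 + slabSide s M 0 / 2) x) = u x) :
    Tendsto (fun N : ℕ => ∫ x, boxOsc (slabCorner c s M i) (slabSide s M) N x *
      rieszTransform 0 (boxOsc c s (M * N)) x ^ e * u x) atTop (𝓝 0) := by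
  have hM : 0 < M := by omega
  have he1 : 1 ≤ e := by omega
  have hs' : 0 < slabSide s M 0 := slabSide_pos hs hM
  have hlim := ENNReal.Tendsto.const_mul (tendsto_eLpNorm_rieszTransform_pow_sub_slab (c := c) hs
    hi 0 he) (Or.inr (ENNReal.ofReal_ne_top (r := B)))
  rw [mul_zero] at hlim
  rw [tendsto_iff_edist_tendsto_0]
  simp_rw [edist_zero_right]
  refine tendsto_of_tendsto_of_tendsto_of_le_of_le' tendsto_const_nhds hlim
    (.of_forall fun _ => zero_le) ?_
  filter_upwards [eventually_gt_atTop 0] with N hN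
  have hMN : 0 < M * N := by positivity
  set D := halfOpenBox (slabCorner c s M i) (slabSide s M) with hD
  set f := boxOsc (slabCorner c s M i) (slabSide s M) N with hf
  set g := rieszTransform 0 f with hg
  set G := rieszTransform 0 (boxOsc c s (M * N)) with hG
  have hint : ∀ H : EuclideanSpace ℝ (Fin n) → ℝ, Integrable (fun x => H x ^ e) →
      Integrable fun x => f x * H x ^ e * u x := by
    intro H hH
    refine (hH.bdd_mul (c := 1) (measurable_boxOsc _ _ _).aestronglyMeasurable
      (.of_forall fun x => abs_boxOsc_le_one hs' N x)).mul_bdd (c := B)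
      hum.aestronglyMeasurable (.of_forall hB)
  have e1 : ∫ x, f x * G x ^ e * u x = ∫ x, f x * (G x ^ e - g x ^ e) * u x := by
    have h0 : ∫ x, f x * g x ^ e * u x = 0 := integral_boxOsc_mul_eq_zero _ _ hN e hu
    rw [← sub_zero (∫ x, f x * G x ^ e * u x), ← h0, ← integral_sub
      (hint G (integrable_rieszTransform_boxOsc_pow hs he1 0 hMN))
      (hint g (integrable_rieszTransform_boxOsc_pow hs' he1 0 hN))]
    congr 1
    ext x
    ring
  rw [e1, ENNReal.ofReal_one, eLpNorm_one_eq_lintegral_enorm,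
    ← lintegral_const_mul' _ _ ENNReal.ofReal_ne_top,
    ← lintegral_indicator (measurableSet_halfOpenBox _ _)]
  refine (enorm_integral_le_lintegral_enorm _).trans (lintegral_mono fun x => ?_)
  by_cases hx : x ∈ D
  · rw [Set.indicator_of_mem hx, enorm_mul, enorm_mul]
    have h1 : ‖f x‖ₑ ≤ 1 := by
      rw [Real.enorm_eq_ofReal_abs, ENNReal.ofReal_le_one]
      exact abs_boxOsc_le_one hs' N x
    have h2 : ‖u x‖ₑ ≤ ENNReal.ofReal B := by
      rw [Real.enorm_eq_ofReal_abs]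
      exact ENNReal.ofReal_le_ofReal (hB x)
    calc ‖f x‖ₑ * ‖G x ^ e - g x ^ e‖ₑ * ‖u x‖ₑ
        ≤ 1 * ‖G x ^ e - g x ^ e‖ₑ * ENNReal.ofReal B := by gcongr
      _ = _ := by rw [one_mul, mul_comm]
  · rw [hf, boxOsc_eq_zero hs' N hx]
    simp

/-- The orthogonal projection of `x` to the hyperplane `x 0 = m`. -/
def projFirst [NeZero n] (m : ℝ) (x : EuclideanSpace ℝ (Fin n)) : EuclideanSpace ℝ (Fin n) :=
  x + EuclideanSpace.single 0 (m - x 0)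

lemma projFirst_reflectFirst [NeZero n] (m : ℝ) (x : EuclideanSpace ℝ (Fin n)) :
    projFirst m (reflectFirst m x) = projFirst m x := by
  ext i
  rcases eq_or_ne i 0 with rfl | hi
  · simp [projFirst]
  · simp [projFirst, hi, reflectFirst_of_ne m x hi]

lemma continuous_projFirst [NeZero n] (m : ℝ) : Continuous (projFirst (n := n) m) := by
  unfold projFirst
  have : (fun x : EuclideanSpace ℝ (Fin n) => EuclideanSpace.single 0 (m - x 0)) =
      fun x => (m - x 0) • EuclideanSpace.single (0 : Fin n) (1 : ℝ) := by
    ext x i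
    simp
  exact continuous_id.add (this ▸ by fun_prop)

lemma dist_projFirst [NeZero n] (m : ℝ) (x : EuclideanSpace ℝ (Fin n)) :
    dist x (projFirst m x) = |m - x 0| := by
  rw [projFirst, dist_self_add_right, PiLp.norm_single, Real.norm_eq_abs]

lemma tendsto_integral_boxOsc_mul_pow [NeZero n] {c s : Fin n → ℝ} (hs : 0 < s 0)
    {e : ℕ} (he : e = 1 ∨ e = 2) {g : EuclideanSpace ℝ (Fin n) → ℝ} (hg : Continuous g)
    (hgc : HasCompactSupport g) :
    Tendsto (fun k : ℕ => ∫ x, boxOsc c s (2 ^ (k - 1)) x *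
      rieszTransform 0 (boxOsc c s (2 ^ (k - 1))) x ^ e * g x) atTop (𝓝 0) := by
  have he1 : 1 ≤ e := by omega
  obtain ⟨B, hB⟩ := hgc.exists_bound_of_continuous hg
  obtain ⟨A, hA0, hA⟩ := exists_integral_abs_rieszTransform_pow_le (c := c) hs he1 0
  rw [Metric.tendsto_nhds]
  intro η hη
  -- On slabs of width at most `d` the test function is almost independent of the first coordinate.
  set ε := η / (2 * (A + 1)) with hε
  have hε0 : 0 < ε := by positivity
  have hεA : ε * A < η / 2 := by
    rw [hε, div_mul_eq_mul_div, div_lt_div_iff₀ (by positivity) two_pos]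
    nlinarith
  obtain ⟨d, hd, hgd⟩ := Metric.uniformContinuous_iff.1
    (hgc.uniformContinuous_of_continuous hg) ε hε0
  obtain ⟨m, hm⟩ : ∃ m : ℕ, s 0 / 2 ^ m < d := by
    obtain ⟨m, hm⟩ := pow_unbounded_of_one_lt (s 0 / d) one_lt_two
    refine ⟨m, ?_⟩
    rw [div_lt_iff₀ hd] at hm
    rw [div_lt_iff₀ (by positivity), mul_comm]
    exact hm
  set M := 2 ^ m with hMdef
  have hM : 0 < M := by positivity
  have hMd : s 0 / M < d := by
    rw [hMdef]
    push_cast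
    exact hm
  have hs' : 0 < slabSide s M 0 := slabSide_pos hs hM
  set u : ℕ → EuclideanSpace ℝ (Fin n) → ℝ := fun i x =>
    g (projFirst (slabCorner c s M i 0 + slabSide s M 0 / 2) x) with hu
  have hum : ∀ i, Measurable (u i) := fun i => (hg.comp (continuous_projFirst _)).measurable
  have hlim : Tendsto (fun N : ℕ => ∑ i ∈ Finset.range M, ∫ x,
      boxOsc (slabCorner c s M i) (slabSide s M) N x *
      rieszTransform 0 (boxOsc c s (M * N)) x ^ e * u i x) atTop (𝓝 0) := by
    have := tendsto_finsetSum (Finset.range M) fun i hi =>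
      tendsto_integral_slab_mul_even (c := c) hs (Finset.mem_range.1 hi) he (hum i)
        (fun x => hB _) fun x => by rw [hu]; simp only [projFirst_reflectFirst]
    simpa only [Finset.sum_const_zero] using this
  have hexp : Tendsto (fun k : ℕ => 2 ^ (k - 1 - m)) atTop atTop := by
    have h1 : Tendsto (fun k : ℕ => k - 1 - m) atTop atTop := by
      simp only [Nat.sub_sub]
      exact tendsto_sub_atTop_nat _
    exact (tendsto_pow_atTop_atTop_of_one_lt (one_lt_two (α := ℕ))).comp h1
  filter_upwards [Metric.tendsto_nhds.1 (hlim.comp hexp) (η / 2) (by positivity),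
    eventually_ge_atTop (m + 1)] with k hk hkm
  simp only [Function.comp_apply] at hk
  set N := 2 ^ (k - 1 - m) with hN
  have hN0 : 0 < N := by positivity
  have hMN : 2 ^ (k - 1) = M * N := by
    rw [hMdef, hN, ← pow_add]
    congr 1
    omega
  rw [hMN]
  have hMN0 : 0 < M * N := by positivity
  set G := rieszTransform 0 (boxOsc c s (M * N)) with hG
  have hGi : Integrable fun x => G x ^ e := integrable_rieszTransform_boxOsc_pow hs he1 0 hMN0
  set f : ℕ → EuclideanSpace ℝ (Fin n) → ℝ := fun i =>
    boxOsc (slabCorner c s M i) (slabSide s M) N with hf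
  have hint : ∀ i, ∀ v : EuclideanSpace ℝ (Fin n) → ℝ, Measurable v → (∀ x, |v x| ≤ B) →
      Integrable fun x => f i x * G x ^ e * v x := by
    intro i v hv hvB
    exact (hGi.bdd_mul (c := 1) (measurable_boxOsc _ _ _).aestronglyMeasurable
      (.of_forall fun x => abs_boxOsc_le_one hs' N x)).mul_bdd (c := B)
      hv.aestronglyMeasurable (.of_forall hvB)
  have hsplit : ∫ x, boxOsc c s (M * N) x * G x ^ e * g x =
      (∑ i ∈ Finset.range M, ∫ x, f i x * G x ^ e * u i x) +
        ∫ x, G x ^ e * ∑ i ∈ Finset.range M, f i x * (g x - u i x) := by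
    have h1 : ∀ i, ∫ x, f i x * G x ^ e * g x = (∫ x, f i x * G x ^ e * u i x) +
        ∫ x, (f i x * G x ^ e * g x - f i x * G x ^ e * u i x) := by
      intro i
      rw [integral_sub (hint i g hg.measurable hB) (hint i _ (hum i) fun x => hB _)]
      ring
    have h2 : ∫ x, boxOsc c s (M * N) x * G x ^ e * g x =
        ∑ i ∈ Finset.range M, ∫ x, f i x * G x ^ e * g x := by
      rw [← integral_finsetSum _ fun i _ => hint i g hg.measurable hB]
      congr 1
      ext x
      rw [boxOsc_eq_sum_slab c s M hN0, Finset.sum_mul, Finset.sum_mul]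
    have h3 : ∑ i ∈ Finset.range M, ∫ x, (f i x * G x ^ e * g x - f i x * G x ^ e * u i x) =
        ∫ x, ∑ i ∈ Finset.range M, (f i x * G x ^ e * g x - f i x * G x ^ e * u i x) :=
      (integral_finsetSum _ fun i _ =>
        (hint i g hg.measurable hB).sub (hint i _ (hum i) fun x => hB _)).symm
    rw [h2, Finset.sum_congr rfl fun i _ => h1 i, Finset.sum_add_distrib, h3]
    congr 2
    ext x
    rw [Finset.mul_sum]
    exact Finset.sum_congr rfl fun i _ => by ring
  have herr : ‖∫ x, G x ^ e * ∑ i ∈ Finset.range M, f i x * (g x - u i x)‖ ≤ ε * A := by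
    refine (norm_integral_le_of_norm_le (hGi.abs.const_mul ε) (.of_forall fun x => ?_)).trans ?_
    · rw [norm_mul, mul_comm ε]
      refine mul_le_mul_of_nonneg_left ?_ (norm_nonneg _)
      have h1 : ∀ i, |f i x * (g x - u i x)| ≤ |f i x| * ε := by
        intro i
        by_cases hx : x ∈ halfOpenBox (slabCorner c s M i) (slabSide s M)
        · rw [abs_mul]
          refine mul_le_mul_of_nonneg_left (hgd ?_).le (abs_nonneg _)
          refine (dist_projFirst _ x).trans_lt (lt_of_le_of_lt ?_ hMd)
          have := hx 0
          rw [slabSide_zero] at this ⊢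
          rw [abs_le]
          have hpos : 0 < s 0 / M := by positivity
          constructor <;> linarith [this.1, this.2]
        · rw [hf]
          simp [boxOsc_eq_zero hs' N hx]
      calc ‖∑ i ∈ Finset.range M, f i x * (g x - u i x)‖
          ≤ ∑ i ∈ Finset.range M, |f i x| * ε :=
            (Finset.abs_sum_le_sum_abs _ _).trans (Finset.sum_le_sum fun i _ => h1 i)
        _ = (∑ i ∈ Finset.range M, |f i x|) * ε := by rw [Finset.sum_mul]
        _ ≤ 1 * ε := by
            gcongr
            exact sum_abs_boxOsc_slab_le hs hM N x
        _ = ε := one_mul _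
    · rw [integral_const_mul]
      gcongr
      exact hA _ hMN0
  rw [dist_zero_right] at hk ⊢
  rw [hsplit]
  exact (norm_add_le _ _).trans_lt (by linarith)

lemma eLpNorm_boxOsc_mul_le [NeZero n] {c s : Fin n → ℝ} (hs : 0 < s 0) (N : ℕ)
    (h : EuclideanSpace ℝ (Fin n) → ℝ) (p : ENNReal) :
    eLpNorm (fun x => boxOsc c s N x * h x) p ≤
      eLpNorm h p (volume.restrict (halfOpenBox c s)) := by
  rw [← eLpNorm_indicator_eq_eLpNorm_restrict (measurableSet_halfOpenBox c s)]
  refine eLpNorm_mono fun x => ?_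
  by_cases hx : x ∈ halfOpenBox c s
  · rw [Set.indicator_of_mem hx, norm_mul]
    exact mul_le_of_le_one_left (norm_nonneg _) (abs_boxOsc_le_one hs N x)
  · simp [boxOsc_eq_zero hs N hx]

/-- The diagonal case: the oscillation of a box times its own Riesz transform, or the square of
it, converges weakly to zero. -/
lemma weaklyTendstoZero_boxOsc_mul_pow [NeZero n] {c s : Fin n → ℝ} (hs : 0 < s 0) {p : ℝ}
    (hp : 1 < p) {e : ℕ} (he : e = 1 ∨ e = 2) :
    WeaklyTendstoZero p fun k x => boxOsc c s (2 ^ (k - 1)) x *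
      rieszTransform 0 (boxOsc c s (2 ^ (k - 1))) x ^ e := by
  have hpow : ∃ C : ENNReal, C ≠ ⊤ ∧ ∀ N : ℕ, 0 < N →
      AEStronglyMeasurable (fun x => rieszTransform 0 (boxOsc c s N) x ^ e) ∧
      eLpNorm (fun x => rieszTransform 0 (boxOsc c s N) x ^ e) (ENNReal.ofReal p) ≤ C := by
    rcases he with rfl | rfl
    · obtain ⟨C, hC, h⟩ := exists_eLpNorm_rieszTransform_le (c := c) hs hp.le 0
      refine ⟨C, hC, fun N hN => ?_⟩
      simp only [pow_one]
      exact ⟨(memLp_rieszTransform_boxOsc hs hp.le 0 hN).1, h N hN⟩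
    · obtain ⟨C, hC, h⟩ := exists_eLpNorm_rieszTransform_le (c := c) hs (q := 2 * p)
        (by linarith) 0
      refine ⟨C * C, ENNReal.mul_ne_top hC hC, fun N hN => ?_⟩
      have hm := (memLp_rieszTransform_boxOsc (c := c) hs hp.le 0 hN).1
      refine ⟨hm.pow 2, ?_⟩
      simp only [pow_two]
      exact (eLpNorm_mul_le_mul_eLpNorm_two_mul (by linarith) hm hm).trans
        (mul_le_mul' (h N hN) (h N hN))
  obtain ⟨C, hC, h⟩ := hpow
  have hN : ∀ k : ℕ, 0 < 2 ^ (k - 1) := fun k => by positivity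
  have hle : ∀ k : ℕ, eLpNorm (fun x => boxOsc c s (2 ^ (k - 1)) x *
      rieszTransform 0 (boxOsc c s (2 ^ (k - 1))) x ^ e) (ENNReal.ofReal p) ≤ C := fun k =>
    (eLpNorm_boxOsc_mul_le hs _ _ _).trans
      ((eLpNorm_mono_measure _ Measure.restrict_le_self).trans (h _ (hN k)).2)
  refine weaklyTendstoZero_of_forall_continuous hp (fun k => ⟨?_, (hle k).trans_lt hC.lt_top⟩)
    hC hle fun g hg hgc => tendsto_integral_boxOsc_mul_pow hs he hg hgc
  exact (measurable_boxOsc c s _).aestronglyMeasurable.mul (h _ (hN k)).1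

/-! ### Cubes of a dyadic grid -/

/-- The half-open cube underlying a `Cube`. -/
def Cube.toSet (Q : Cube n) : Set (EuclideanSpace ℝ (Fin n)) :=
  halfOpenBox Q.corner fun _ => Q.side

/-- Distinct cubes of the same size in a dyadic grid are disjoint. -/
lemma Cube.toSet_subset_compl {Q₀ I J : Cube n} (hI : I ∈ dyadicGrid Q₀) (hJ : J ∈ dyadicGrid Q₀)
    (hIJ : I.side = J.side) (hne : I ≠ J) : I.toSet ⊆ J.toSetᶜ := by
  obtain ⟨-, z, hz⟩ := hI
  obtain ⟨-, w, hw⟩ := hJ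
  intro x hx hx'
  refine hne (Cube.ext (funext fun i => ?_) hIJ)
  have h1 := hx i
  have h2 := hx' i
  simp only [hz, hw, ← hIJ] at h1 h2
  have hpos := I.side_pos
  have h3 : (z i : ℝ) < w i + 1 := by
    by_contra! h
    nlinarith [h1.1, h2.2]
  have h4 : (w i : ℝ) < z i + 1 := by
    by_contra! h
    nlinarith [h2.1, h1.2]
  have h5 : z i = w i := by
    have h3' : z i < w i + 1 := by exact_mod_cast h3
    have h4' : w i < z i + 1 := by exact_mod_cast h4
    omega
  rw [hz, hw, h5, hIJ]

/-- The Riesz transform of the horizontal alternating function of a cube. -/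
def cubeRiesz [NeZero n] (Q : Cube n) (k : ℕ) : EuclideanSpace ℝ (Fin n) → ℝ :=
  rieszTransform 0 (alternatingHorizontal Q k)

lemma memLp_cubeRiesz [NeZero n] (Q : Cube n) {q : ℝ} (hq : 1 ≤ q) (k : ℕ) :
    MemLp (cubeRiesz Q k) (ENNReal.ofReal q) := by
  rw [cubeRiesz, alternatingHorizontal_eq_boxOsc]
  exact memLp_rieszTransform_boxOsc Q.side_pos hq 0 (by positivity)

lemma exists_eLpNorm_cubeRiesz_le [NeZero n] (Q : Cube n) {q : ℝ} (hq : 1 ≤ q) :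
    ∃ C : ENNReal, C ≠ ⊤ ∧ ∀ k, eLpNorm (cubeRiesz Q k) (ENNReal.ofReal q) ≤ C := by
  obtain ⟨C, hC, h⟩ := exists_eLpNorm_rieszTransform_le (c := Q.corner)
    (s := fun _ => Q.side) Q.side_pos hq 0
  refine ⟨C, hC, fun k => ?_⟩
  rw [cubeRiesz, alternatingHorizontal_eq_boxOsc]
  exact h _ (by positivity)

lemma tendsto_eLpNorm_cubeRiesz_compl [NeZero n] (Q : Cube n) {q : ℝ} (hq : 1 ≤ q) :
    Tendsto (fun k => eLpNorm (cubeRiesz Q k) (ENNReal.ofReal q) (volume.restrict Q.toSetᶜ))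
      atTop (𝓝 0) := by
  have h1 : Tendsto (fun k : ℕ => 2 ^ (k - 1)) atTop atTop :=
    (tendsto_pow_atTop_atTop_of_one_lt (one_lt_two (α := ℕ))).comp (tendsto_sub_atTop_nat 1)
  have h2 := (tendsto_eLpNorm_rieszTransform_compl (c := Q.corner) (s := fun _ => Q.side)
    Q.side_pos hq 0).comp h1
  refine h2.congr fun k => ?_
  rw [cubeRiesz, alternatingHorizontal_eq_boxOsc]
  rfl

/-- A product of two Riesz transforms vanishes asymptotically in `L^p` off either of the cubes. -/
lemma tendsto_eLpNorm_cubeRiesz_mul [NeZero n] (I J : Cube n) {p : ℝ} (hp : 1 < p) :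
    Tendsto (fun k => eLpNorm (fun x => cubeRiesz I k x * cubeRiesz J k x) (ENNReal.ofReal p)
      (volume.restrict I.toSetᶜ)) atTop (𝓝 0) := by
  obtain ⟨C, hC, h⟩ := exists_eLpNorm_cubeRiesz_le J (q := 2 * p) (by linarith)
  have hlim := ENNReal.Tendsto.mul_const (tendsto_eLpNorm_cubeRiesz_compl I (q := 2 * p)
    (by linarith)) (Or.inr hC)
  rw [zero_mul] at hlim
  refine tendsto_of_tendsto_of_tendsto_of_le_of_le tendsto_const_nhds hlim (fun _ => zero_le)
    fun k => ?_
  refine (eLpNorm_mul_le_mul_eLpNorm_two_mul (by linarith)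
    (memLp_cubeRiesz I hp.le k).1.restrict (memLp_cubeRiesz J hp.le k).1.restrict).trans ?_
  gcongr
  exact (eLpNorm_mono_measure _ Measure.restrict_le_self).trans (h k)

lemma memLp_cubeRiesz_mul [NeZero n] (I J : Cube n) {p : ℝ} (hp : 1 < p) (k : ℕ) :
    MemLp (fun x => cubeRiesz I k x * cubeRiesz J k x) (ENNReal.ofReal p) := by
  have hI := memLp_cubeRiesz I (q := 2 * p) (by linarith) k
  have hJ := memLp_cubeRiesz J (q := 2 * p) (by linarith) k
  exact ⟨hI.1.mul hJ.1, (eLpNorm_mul_le_mul_eLpNorm_two_mul (by linarith) hI.1 hJ.1).trans_lt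
    (ENNReal.mul_lt_top hI.2 hJ.2)⟩

lemma eLpNorm_le_restrict_compl_add_restrict {X : Type*} {mX : MeasurableSpace X} {μ : Measure X}
    {f : X → ℝ} (hf : AEStronglyMeasurable f μ) {q : ENNReal} (hq : 1 ≤ q) {s : Set X}
    (hs : MeasurableSet s) :
    eLpNorm f q μ ≤ eLpNorm f q (μ.restrict sᶜ) + eLpNorm f q (μ.restrict s) := by
  rw [← eLpNorm_indicator_eq_eLpNorm_restrict hs.compl, ← eLpNorm_indicator_eq_eLpNorm_restrict hs]
  refine (le_of_eq ?_).trans (eLpNorm_add_le (hf.indicator hs.compl) (hf.indicator hs) hq)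
  rw [Set.indicator_compl_add_self]

/-- For disjoint cubes, the first factor is small off `I`, and the second one is small on `I`. -/
lemma tendsto_eLpNorm_cubeRiesz_mul_of_disjoint [NeZero n] {I J : Cube n}
    (hIJ : I.toSet ⊆ J.toSetᶜ) {p : ℝ} (hp : 1 < p) :
    Tendsto (fun k => eLpNorm (fun x => cubeRiesz I k x * cubeRiesz J k x) (ENNReal.ofReal p))
      atTop (𝓝 0) := by
  have h1 := tendsto_eLpNorm_cubeRiesz_mul I J hp
  have h2 := tendsto_eLpNorm_cubeRiesz_mul J I hp
  simp only [mul_comm (cubeRiesz J _ _)] at h2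
  have hlim := h1.add h2
  rw [add_zero] at hlim
  refine tendsto_of_tendsto_of_tendsto_of_le_of_le tendsto_const_nhds hlim (fun _ => zero_le)
    fun k => ?_
  exact (eLpNorm_le_restrict_compl_add_restrict (memLp_cubeRiesz_mul I J hp k).1
    (by simpa using hp.le) (measurableSet_halfOpenBox _ _)).trans
    (add_le_add le_rfl (eLpNorm_mono_measure _ (Measure.restrict_mono hIJ le_rfl)))

lemma eLpNorm_alternatingHorizontal_mul_le [NeZero n] (Q : Cube n) (k : ℕ)
    (h : EuclideanSpace ℝ (Fin n) → ℝ) (p : ENNReal) :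
    eLpNorm (fun x => alternatingHorizontal Q k x * h x) p ≤
      eLpNorm h p (volume.restrict Q.toSet) := by
  rw [alternatingHorizontal_eq_boxOsc]
  exact eLpNorm_boxOsc_mul_le Q.side_pos _ h p

lemma weaklyTendstoZero_alternatingHorizontal_mul [NeZero n] {Q : Cube n} {p : ℝ} (hp : 1 < p)
    {h : ℕ → EuclideanSpace ℝ (Fin n) → ℝ} {s : Set (EuclideanSpace ℝ (Fin n))}
    (hQs : Q.toSet ⊆ s) (hm : ∀ k, MemLp (h k) (ENNReal.ofReal p))
    (hlim : Tendsto (fun k => eLpNorm (h k) (ENNReal.ofReal p) (volume.restrict s))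
      atTop (𝓝 0)) :
    WeaklyTendstoZero p fun k x => alternatingHorizontal Q k x * h k x := by
  refine weaklyTendstoZero_of_tendsto_eLpNorm hp (fun k => ⟨?_, ?_⟩) ?_
  · rw [alternatingHorizontal_eq_boxOsc]
    exact (measurable_boxOsc _ _ _).aestronglyMeasurable.mul (hm k).1
  · exact (eLpNorm_alternatingHorizontal_mul_le Q k (h k) _).trans_lt
      ((eLpNorm_mono_measure _ Measure.restrict_le_self).trans_lt (hm k).2)
  · exact tendsto_of_tendsto_of_tendsto_of_le_of_le tendsto_const_nhds hlim (fun _ => zero_le)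
      fun k => (eLpNorm_alternatingHorizontal_mul_le Q k (h k) _).trans
        (eLpNorm_mono_measure _ (Measure.restrict_mono hQs le_rfl))

end

theorem mainTheorem7 {n : ℕ} [NeZero n] (p : ℝ) (hp : 1 < p)
    (Q₀ I J K : Cube n)
    (hI : I ∈ dyadicGrid Q₀) (hJ : J ∈ dyadicGrid Q₀) (hK : K ∈ dyadicGrid Q₀)
    (hIJ : I.side = J.side) (hJK : J.side = K.side) :
    (∀ (P : Cube n) (k : ℕ), ∀ᵐ x, RieszPVExists 0 (alternatingHorizontal P k) x) ∧
    WeaklyTendstoZero p (fun k x =>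
      alternatingHorizontal I k x * rieszTransform 0 (alternatingHorizontal J k) x) ∧
    (I ≠ J → WeaklyTendstoZero p (fun k x =>
      rieszTransform 0 (alternatingHorizontal I k) x *
        rieszTransform 0 (alternatingHorizontal J k) x)) ∧
    WeaklyTendstoZero p (fun k x =>
      alternatingHorizontal I k x * rieszTransform 0 (alternatingHorizontal J k) x *
        rieszTransform 0 (alternatingHorizontal K k) x) := by
  refine ⟨fun P k => ?_, ?_, fun hne => ?_, ?_⟩
  · rw [alternatingHorizontal_eq_boxOsc]
    exact ae_rieszPVExists_boxOsc P.side_pos (by positivity) 0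
  · rcases eq_or_ne I J with rfl | hne
    · simp only [alternatingHorizontal_eq_boxOsc]
      simpa only [pow_one] using
        weaklyTendstoZero_boxOsc_mul_pow (c := I.corner) (s := fun _ => I.side) I.side_pos hp
          (Or.inl rfl)
    · exact weaklyTendstoZero_alternatingHorizontal_mul hp
        (Cube.toSet_subset_compl hI hJ hIJ hne) (fun k => memLp_cubeRiesz J hp.le k)
        (tendsto_eLpNorm_cubeRiesz_compl J hp.le)
  · exact weaklyTendstoZero_of_tendsto_eLpNorm hp (fun k => memLp_cubeRiesz_mul I J hp k)
      (tendsto_eLpNorm_cubeRiesz_mul_of_disjoint (Cube.toSet_subset_compl hI hJ hIJ hne) hp)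
  · simp only [mul_assoc]
    rcases eq_or_ne I J with rfl | hne
    · rcases eq_or_ne I K with rfl | hne'
      · simp only [alternatingHorizontal_eq_boxOsc]
        simpa only [pow_two] using
          weaklyTendstoZero_boxOsc_mul_pow (c := I.corner) (s := fun _ => I.side) I.side_pos hp
            (Or.inr rfl)
      · refine weaklyTendstoZero_alternatingHorizontal_mul hp
          (Cube.toSet_subset_compl hI hK hJK hne') (fun k => memLp_cubeRiesz_mul I K hp k) ?_
        have hlim := tendsto_eLpNorm_cubeRiesz_mul K I hp
        simp only [mul_comm (cubeRiesz K _ _)] at hlim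
        exact hlim
    · exact weaklyTendstoZero_alternatingHorizontal_mul hp
        (Cube.toSet_subset_compl hI hJ hIJ hne) (fun k => memLp_cubeRiesz_mul J K hp k)
        (tendsto_eLpNorm_cubeRiesz_mul J K hp)
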